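/- Throughout $\mathbb N=\{1,2,\dots\}$, $\omega_1$ is the set of countable ordinals, and $\phi<\psi$ for finitely supported functions means that every element of $\operatorname{supp}\phi$ is below every element of $\operatorname{supp}\psi$. **$\varrho$-functions.** A $\varrho$-function is a map $\varrho:[\omega_1]^2\to\omega$ such that for all $\alpha<\beta<\gamma<\omega_1$ one has $\varrho(\alpha,\gamma)\le\max\{\varrho(\alpha,\beta),\varrho(\beta,\gamma)\}$ and $\varrho(\alpha,\beta)\le\max\{\varrho(\alpha,\gamma),\varrho(\beta,\gamma)\}$, and such that $F_n^\beta=\{\alpha<\beta:\varrho(\alpha,\beta)\le n\}$ is finite for all $\beta<\omega_1$, $n\in\omega$. It is smooth if for every limit ordinal $\lambda<\omega_1$ we have $D_\lambda:=\sup_{n\ge1}\#F_n^\lambda/n<\infty$. For finite $F\subseteq\omega_1$ let $p_F$ be the maximum of $\varrho(\alpha,\beta)$ over $\alpha<\beta$ in $F$ ($0$ if there is no such pair), and let $\overline F^{\,p}$ be the set of all $\alpha$ for which there is $\beta\in F$ with $\alpha=\beta$, or with $\alpha<\beta$ and $\varrho(\alpha,\beta)\le p$. **Coding.** Let $m_1=2$,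 $m_{j+1}=m_j^4$, $n_1=4$, $n_{j+1}=(4n_j)^{s_j}$ with $s_j=\log_2 m_{j+1}^3$. Let $\mathbb Q_s$ be the set of nonempty finite sequences $(\phi_1,w_1,p_1,\dots,\phi_d,w_d,p_d)$ with non-zero finitely supported $\phi_i:\mathbb N\to\mathbb Q$, $\phi_1<\dots<\phi_d$, and $(w_i)$, $(p_i)$ strictly increasing in $\mathbb N$. Let $\mathbb Q_s(\omega_1)$ be defined in the same way with $\phi_i:\omega_1\to\mathbb Q$ and the additional requirement $p_i\ge p_{\operatorname{supp}\phi_1\cup\dots\cup\operatorname{supp}\phi_i}$ for all $i\le d$. A coding is a one-to-one map $\sigma:\mathbb Q_s\to\{2j:j\text{ odd}\}$ with $\sigma(\phi_1,w_1,p_1,\dots,\phi_d,w_d,p_d)>\max\{p_d^2,\varepsilon^{-2},\max\operatorname{supp}\phi_d\}$, where $\varepsilon$ is the least $|\phi_k(a)|$ with $k\le d$, $a\in\operatorname{supp}\phi_k$. For $\Phi=(\phi_1,w_1,p_1,\dots,\phi_d,w_d,p_d)\in\mathbb Q_s(\omega_1)$ let $G$ be the $p_d$-closure $\overline{\operatorname{supp}\phi_1\cup\dots\cup\operatorname{supp}\phi_d}^{\,p_d}$,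 replace every $\phi_k$ by the function on $\mathbb N$ that carries its values over along the increasing bijection $\{1,\dots,\#G\}\to G$ and vanishes beyond $\#G$, and let $\sigma_\varrho(\Phi)$ be the value of $\sigma$ at the resulting element of $\mathbb Q_s$. **The space.** Let $K=K_{\omega_1}$ be the least set of finitely supported functions $\omega_1\to\mathbb Q$ that contains all $e_\alpha^*=\chi_{\{\alpha\}}$; is closed under $\phi\mapsto-\phi$, under restriction to intervals of $\omega_1$ and under rational convex combinations; contains $m_{2j}^{-1}\sum_{i=1}^{n_{2j}}\phi_i$ whenever $j\in\mathbb N$, $\phi_i\in K$ and $\phi_i<\phi_k$ for $i<k$; and contains $m_{2j+1}^{-1}\sum_{i=1}^{n_{2j+1}}\phi_i$ whenever $j\in\mathbb N$ and $(\phi_1,\dots,\phi_{n_{2j+1}})$ is a $(2j+1)$-special sequence. The latter means that $\phi_1<\dots<\phi_{n_{2j+1}}$ are non-zero elements of $K$, and that there are $j_1,j_2,\ldots\in\mathbb N$ and natural numbers $p_1<p_2<\cdots$ such that: each $\phi_i$ is, up to sign, the restriction to an interval of some $m_{2j_i}^{-1}\sum_{l=1}^{n_{2j_i}}f_l$ with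 $f_l\in K$ and $f_l<f_{l'}$ for $l<l'$; $j_1$ is even and $m_{2j_1}>n_{2j+1}^2$; and for $1\le i<n_{2j+1}$ the sequence $\Phi_i=(\phi_1,m_{2j_1},p_1,\dots,\phi_i,m_{2j_i},p_i)$ lies in $\mathbb Q_s(\omega_1)$ and $m_{2j_{i+1}}=m_{\sigma_\varrho(\Phi_i)}$. Let $\mathfrak X_{\omega_1}$ be the completion of $c_{00}(\omega_1)$ (real scalars) under $\|x\|=\sup_{\phi\in K}\sum_\alpha\phi(\alpha)x(\alpha)$, let $(e_\alpha)_{\alpha<\omega_1}$ be the unit vectors, and let $\mathfrak X_\alpha$ be the closed linear span of $(e_\beta)_{\beta<\alpha}$. **Theorem.** 1. There exists a smooth $\varrho$-function. 2. Let $\varrho$ be any smooth $\varrho$-function and $\sigma$ any coding, and let $\mathfrak X_{\omega_1}$ be the space built from them. (a) For every limit ordinal $\lambda<\omega_1$ and every $n\in\omega$ there is a bounded projection $P_{F_n^\lambda}$ on $\mathfrak X_{\omega_1}$ with $P_{F_n^\lambda}e_\beta=e_\beta$ for $\beta\in F_n^\lambda$ and $P_{F_n^\lambda}e_\beta=0$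 for $\beta\notin F_n^\lambda$. Moreover $\|P_{F_n^\lambda}\|\le 2+D_\lambda$ for all $n$, and $\lim_{n\to\infty}P_{F_n^\lambda}x=x$ for every $x\in\mathfrak X_\lambda$. (b) For every infinite $\alpha<\omega_1$ there is a reordering $(e_{\beta_n})_{n}$ of $(e_\beta)_{\beta<\alpha}$ in order type $\omega$ that is a Schauder basis of $\mathfrak X_\alpha$. For finite $\alpha$, $(e_\beta)_{\beta<\alpha}$ is a (finite) basis of $\mathfrak X_\alpha$. -/

import Mathlib

open scoped Ordinal

noncomputable section

namespace RhoSpace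

/-- The set `ω₁` of all countable ordinals, with its well-order. -/
abbrev Omega1 : Type 1 := Set.Iio (ω₁ : Ordinal.{0})

/-! ### Functions `ϱ : [ω₁]² → ω` -/

/-- A `ϱ`-function on `[ω₁]²`. Only the values `ϱ(α, β)` with `α < β` carry meaning, and no other
value is used below. -/
structure RhoFunction where
  toFun : Omega1 → Omega1 → ℕ
  le_max_trans : ∀ α β γ : Omega1, α < β → β < γ →
    toFun α γ ≤ max (toFun α β) (toFun β γ)
  le_max_common : ∀ α β γ : Omega1, α < β → β < γ →
    toFun α β ≤ max (toFun α γ) (toFun β γ)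
  finite_le : ∀ (β : Omega1) (n : ℕ), {α : Omega1 | α < β ∧ toFun α β ≤ n}.Finite

namespace RhoFunction

/-- `F_n^β = {α < β : ϱ(α, β) ≤ n}`. -/
def initial (ϱ : RhoFunction) (β : Omega1) (n : ℕ) : Finset Omega1 :=
  (ϱ.finite_le β n).toFinset

/-- `ϱ` is smooth: for every limit `l < ω₁` the sequence `(#F_n^l / n)_{n ≥ 1}` is bounded. -/
def IsSmooth (ϱ : RhoFunction) : Prop :=
  ∀ l : Omega1, Order.IsSuccLimit (l : Ordinal.{0}) →
    BddAbove (Set.range fun n : ℕ+ => ((ϱ.initial l n).card : ℝ) / (n : ℕ))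

open scoped Classical in
/-- `p_F`, the maximum of `ϱ(α, β)` over `α < β` in `F` (`0` if there is no such pair). -/
def maxOn (ϱ : RhoFunction) (F : Finset Omega1) : ℕ :=
  ((F ×ˢ F).filter fun q => q.1 < q.2).sup fun q => ϱ.toFun q.1 q.2

open scoped Classical in
/-- The `p`-closure of `F`: all `α` such that some `β ∈ F` has `α = β`, or `α < β` and
`ϱ(α, β) ≤ p`. -/
def cl (ϱ : RhoFunction) (F : Finset Omega1) (p : ℕ) : Finset Omega1 :=
  F.biUnion fun β => insert β (ϱ.initial β p)

lemma mem_cl {ϱ : RhoFunction} {F : Finset Omega1} {p : ℕ} {α : Omega1} :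
    α ∈ ϱ.cl F p ↔ ∃ β ∈ F, α = β ∨ (α < β ∧ ϱ.toFun α β ≤ p) := by
  simp [cl, initial]

end RhoFunction

/-! ### The parameters `(m_j)`, `(n_j)` for `j = 1, 2, …`; the values at `0` are never used -/

/-- `m_1 = 2`, `m_{j+1} = m_j ^ 4`. -/
def mSeq : ℕ → ℕ
  | 0 => 1
  | 1 => 2
  | j + 2 => mSeq (j + 1) ^ 4

/-- `n_1 = 4`, `n_{j+1} = (4 n_j) ^ (log₂ (m_{j+1} ^ 3))`; the logarithm is an integer, since
`m_{j+1}` is a power of `2`. -/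
def nSeq : ℕ → ℕ
  | 0 => 1
  | 1 => 4
  | j + 2 => (4 * nSeq (j + 1)) ^ Nat.log 2 (mSeq (j + 2) ^ 3)

/-! ### Codes of block sequences and the coding -/

/-- One block `(φ, w, p)` of a code `(φ_1, w_1, p_1, …, φ_d, w_d, p_d)`. -/
structure CodeEntry (Γ : Type*) where
  functional : Γ →₀ ℚ
  weight : ℕ
  param : ℕ

/-- `φ < ψ`: every element of the support of `φ` is below every element of that of `ψ`. -/
def SuppLT {Γ : Type*} [LinearOrder Γ] (φ ψ : Γ →₀ ℚ) : Prop :=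
  ∀ a ∈ φ.support, ∀ b ∈ ψ.support, a < b

/-- Nonempty finite sequences `(φ_1, w_1, p_1, …, φ_d, w_d, p_d)` with non-zero rational
`φ_1 < ⋯ < φ_d` and strictly increasing positive integers `w_i` and `p_i`. -/
structure IsBlockCode {Γ : Type*} [LinearOrder Γ] (Φ : List (CodeEntry Γ)) : Prop where
  ne_nil : Φ ≠ []
  ne_zero : ∀ a ∈ Φ, a.functional ≠ 0
  pos : ∀ a ∈ Φ, 0 < a.weight ∧ 0 < a.param
  increasing : Φ.Pairwise fun a b =>
    SuppLT a.functional b.functional ∧ a.weight < b.weight ∧ a.param < b.param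

/-- The countable set `ℚ_s` of codes on `{1, 2, …}`. -/
def Qs : Set (List (CodeEntry ℕ+)) := {Φ | IsBlockCode Φ}

open scoped Classical in
/-- The union of the supports of the functionals of a code. -/
def codeSupport {Γ : Type*} (Φ : List (CodeEntry Γ)) : Finset Γ :=
  (Φ.map CodeEntry.functional).toFinset.biUnion Finsupp.support

lemma mem_codeSupport {Γ : Type*} {Φ : List (CodeEntry Γ)} {α : Γ} :
    α ∈ codeSupport Φ ↔ ∃ a ∈ Φ, α ∈ a.functional.support := by
  simp [codeSupport]

/-- The set `ℚ_s(ω₁)`: codes on `ω₁` with `p_i ≥ p_{supp φ_1 ∪ ⋯ ∪ supp φ_i}` for all `i`. -/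
def QsOmega1 (ϱ : RhoFunction) : Set (List (CodeEntry Omega1)) :=
  {Φ | IsBlockCode Φ ∧
    ∀ (i : ℕ) (h : i < Φ.length), ϱ.maxOn (codeSupport (Φ.take (i + 1))) ≤ Φ[i].param}

/-- A one-to-one `σ : ℚ_s → {2j : j odd}` whose value at `(φ_1, w_1, p_1, …, φ_d, w_d, p_d)`
exceeds `p_d²`, `1/ε²` with `ε` the least modulus of a non-zero value of some `φ_k`, and
`max supp φ_d`. Values off `ℚ_s` are irrelevant. -/
structure Coding where
  toFun : List (CodeEntry ℕ+) → ℕ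
  injOn : Set.InjOn toFun Qs
  eq_two_mul_odd : ∀ Φ ∈ Qs, ∃ j, Odd j ∧ toFun Φ = 2 * j
  param_sq_lt : ∀ Φ ∈ Qs, ∀ h : Φ ≠ [], (Φ.getLast h).param ^ 2 < toFun Φ
  inv_sq_lt : ∀ Φ ∈ Qs, ∀ a ∈ Φ, ∀ k ∈ a.functional.support,
    1 / |a.functional k| ^ 2 < (toFun Φ : ℚ)
  support_lt : ∀ Φ ∈ Qs, ∀ h : Φ ≠ [], ∀ k ∈ (Φ.getLast h).functional.support,
    (k : ℕ) < toFun Φ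

instance : Nonempty Coding := by
  classical
  have hc : Countable (List (CodeEntry ℕ+)) := by
    have hinj : Function.Injective fun a : CodeEntry ℕ+ => (a.functional, a.weight, a.param) := by
      rintro ⟨_, _, _⟩ ⟨_, _, _⟩ h
      simpa using h
    have := hinj.countable
    infer_instance
  obtain ⟨c, hcinj⟩ := hc.exists_injective_nat
  -- an upper bound for all the required lower bounds
  have hB : ∀ Φ : List (CodeEntry ℕ+), ∃ B : ℕ, ∀ a ∈ Φ, a.param ^ 2 ≤ B ∧
      ∀ k ∈ a.functional.support, 1 / |a.functional k| ^ 2 ≤ (B : ℚ) ∧ (k : ℕ) ≤ B := by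
    intro Φ
    refine ⟨(Φ.map fun a => a.param ^ 2 + ∑ k ∈ a.functional.support,
      (⌈1 / |a.functional k| ^ 2⌉₊ + PNat.val k)).sum, fun a ha => ?_⟩
    have h1 := List.single_le_sum (l := Φ.map fun a => a.param ^ 2 + ∑ k ∈ a.functional.support,
      (⌈1 / |a.functional k| ^ 2⌉₊ + PNat.val k)) (fun _ _ => Nat.zero_le _) _
      (List.mem_map_of_mem ha)
    refine ⟨le_trans (Nat.le_add_right _ _) h1, fun k hk => ?_⟩
    have h2 := Finset.single_le_sum (f := fun k => ⌈1 / |a.functional k| ^ 2⌉₊ + PNat.val k)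
      (fun _ _ => Nat.zero_le _) hk
    have h3 := le_trans h2 (le_trans (Nat.le_add_left _ _) h1)
    exact ⟨(Nat.le_ceil _).trans (by exact_mod_cast le_trans (Nat.le_add_right _ _) h3),
      le_trans (Nat.le_add_left _ _) h3⟩
  choose B hB using hB
  have hlt : ∀ Φ, B Φ < 2 * (2 * Nat.pair (c Φ) (B Φ) + 1) := fun Φ => by
    have := Nat.right_le_pair (c Φ) (B Φ)
    omega
  refine ⟨⟨fun Φ => 2 * (2 * Nat.pair (c Φ) (B Φ) + 1), ?_, ?_, ?_, ?_, ?_⟩⟩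
  · intro Φ _ Ψ _ h
    have h' : Nat.pair (c Φ) (B Φ) = Nat.pair (c Ψ) (B Ψ) := by
      simp only at h
      omega
    exact hcinj (Nat.pair_eq_pair.1 h').1
  · exact fun Φ _ => ⟨_, odd_two_mul_add_one _, rfl⟩
  · exact fun Φ _ h => (hB Φ _ (List.getLast_mem h)).1.trans_lt (hlt Φ)
  · exact fun Φ _ a ha k hk => ((hB Φ a ha).2 k hk).1.trans_lt (by exact_mod_cast hlt Φ)
  · exact fun Φ _ h k hk => ((hB Φ _ (List.getLast_mem h)).2 k hk).2.trans_lt (hlt Φ)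

/-- For the order-preserving bijection `π_G : {1, …, #G} → G`, the function on `{1, 2, …}` with
value `φ(π_G(k))` at `k ≤ #G` and `0` at all other `k`. -/
def collapse (G : Finset Omega1) (φ : Omega1 →₀ ℚ) : ℕ+ →₀ ℚ :=
  Finsupp.ofSupportFinite
    (fun k => if h : (k : ℕ) ≤ G.card then
      φ (G.orderEmbOfFin rfl ⟨(k : ℕ) - 1, by have := k.pos; omega⟩) else 0)
    (((Set.finite_Iic G.card).preimage PNat.coe_injective.injOn).subset fun k hk => by
      by_contra hlt
      exact hk (dif_neg hlt))

/-- `G_Φ`, the `p_d`-closure of `supp φ_1 ∪ ⋯ ∪ supp φ_d`. -/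
def codeClosure (ϱ : RhoFunction) (Φ : List (CodeEntry Omega1)) : Finset Omega1 :=
  ϱ.cl (codeSupport Φ) ((Φ.getLast?.map CodeEntry.param).getD 0)

/-- `π_G(Φ)` with `G = G_Φ`. -/
def collapseCode (ϱ : RhoFunction) (Φ : List (CodeEntry Omega1)) : List (CodeEntry ℕ+) :=
  Φ.map fun a =>
    { functional := collapse (codeClosure ϱ Φ) a.functional
      weight := a.weight
      param := a.param }

lemma support_subset_codeClosure (ϱ : RhoFunction) {Φ : List (CodeEntry Omega1)}
    {a : CodeEntry Omega1} (ha : a ∈ Φ) : a.functional.support ⊆ codeClosure ϱ Φ := by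
  intro α hα
  refine RhoFunction.mem_cl.2 ⟨α, ?_, Or.inl rfl⟩
  exact mem_codeSupport.2 ⟨a, ha, hα⟩

lemma mem_support_collapse {G : Finset Omega1} {φ : Omega1 →₀ ℚ} {k : ℕ+}
    (hk : k ∈ (collapse G φ).support) : ∃ h : (k : ℕ) ≤ G.card,
      G.orderEmbOfFin rfl ⟨(k : ℕ) - 1, by have := k.pos; omega⟩ ∈ φ.support := by
  rw [Finsupp.mem_support_iff] at hk
  by_cases h : (k : ℕ) ≤ G.card
  · refine ⟨h, ?_⟩
    rw [Finsupp.mem_support_iff]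
    intro h0
    exact hk ((dif_pos h).trans h0)
  · exact (hk (dif_neg h)).elim

lemma collapseCode_mem_Qs (ϱ : RhoFunction) {Φ : List (CodeEntry Omega1)}
    (hΦ : Φ ∈ QsOmega1 ϱ) : collapseCode ϱ Φ ∈ Qs := by
  obtain ⟨hΦ, -⟩ := hΦ
  refine ⟨?_, ?_, ?_, ?_⟩
  · simpa [collapseCode] using hΦ.ne_nil
  · intro a ha
    obtain ⟨b, hb, rfl⟩ := List.mem_map.1 ha
    obtain ⟨α, hα⟩ := Finsupp.support_nonempty_iff.2 (hΦ.ne_zero b hb)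
    have hG := support_subset_codeClosure ϱ hb hα
    have hr : α ∈ Set.range ((codeClosure ϱ Φ).orderEmbOfFin rfl) := by
      rw [Finset.range_orderEmbOfFin]
      exact hG
    obtain ⟨i, hi⟩ := hr
    intro h0
    have h1 : collapse (codeClosure ϱ Φ) b.functional ⟨i + 1, Nat.succ_pos _⟩ = 0 := by
      rw [show collapse (codeClosure ϱ Φ) b.functional = 0 from h0]
      rfl
    have h2 : b.functional ((codeClosure ϱ Φ).orderEmbOfFin rfl i) = 0 :=
      (dif_pos (show (i : ℕ) + 1 ≤ (codeClosure ϱ Φ).card from i.2)).symm.trans h1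
    rw [hi] at h2
    exact Finsupp.mem_support_iff.1 hα h2
  · intro a ha
    obtain ⟨b, hb, rfl⟩ := List.mem_map.1 ha
    exact hΦ.pos b hb
  · refine List.pairwise_map.2 (hΦ.increasing.imp fun {a b} hab => ⟨?_, hab.2⟩)
    intro k hk k' hk'
    obtain ⟨h, hs⟩ := mem_support_collapse hk
    obtain ⟨h', hs'⟩ := mem_support_collapse hk'
    have hlt := (OrderEmbedding.lt_iff_lt _).1 (hab.1 _ hs _ hs')
    have hlt' : (k : ℕ) - 1 < (k' : ℕ) - 1 := hlt
    exact PNat.coe_lt_coe _ _ |>.1 (by omega)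

/-- `σ_ϱ(Φ) = σ(π_G(Φ))` with `G = G_Φ`. -/
def Coding.rho (σ : Coding) (ϱ : RhoFunction) (Φ : List (CodeEntry Omega1)) : ℕ :=
  σ.toFun (collapseCode ϱ Φ)

/-! ### The norming set -/

/-- `supp φ_1 < supp φ_2 < ⋯` -/
def Successive {N : ℕ} (φ : Fin N → Omega1 →₀ ℚ) : Prop :=
  ∀ i k, i < k → SuppLT (φ i) (φ k)

open scoped Classical in
/-- The restriction of `φ` to the set `I`. -/
def restrict (I : Set Omega1) (φ : Omega1 →₀ ℚ) : Omega1 →₀ ℚ :=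
  φ.filter (· ∈ I)

/-- `φ` is of type I with weight `m_{2j}` relative to `S`: up to sign it is the restriction to an
interval of the result of one `(1/m_{2j}, n_{2j})`-operation on elements of `S`. -/
def IsTypeIEven (S : Set (Omega1 →₀ ℚ)) (j : ℕ) (φ : Omega1 →₀ ℚ) : Prop :=
  ∃ (f : Fin (nSeq (2 * j)) → Omega1 →₀ ℚ) (I : Set Omega1),
    (∀ i, f i ∈ S) ∧ Successive f ∧ I.OrdConnected ∧
    (φ = restrict I ((mSeq (2 * j) : ℚ)⁻¹ • ∑ i, f i) ∨
      φ = -restrict I ((mSeq (2 * j) : ℚ)⁻¹ • ∑ i, f i))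

/-- `(φ_1, …, φ_N)`, `N = n_{2j+1}`, is a `(2j+1)`-special sequence of elements of `S`: there are
`j_1, …, j_N ≥ 1` with `φ_i` of type I and weight `m_{2 j_i}`, with `j_1` even and
`m_{2 j_1} > n_{2j+1}²`, and strictly increasing `p_i` such that
`w(φ_{i+1}) = m_{σ_ϱ(φ_1, w(φ_1), p_1, …, φ_i, w(φ_i), p_i)}`. (The last `p_N` is not used.) -/
def IsSpecial (ϱ : RhoFunction) (σ : Coding) (S : Set (Omega1 →₀ ℚ)) (j : ℕ)
    (φ : Fin (nSeq (2 * j + 1)) → Omega1 →₀ ℚ) : Prop :=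
  (∀ i, φ i ∈ S) ∧ (∀ i, φ i ≠ 0) ∧ Successive φ ∧
  ∃ (js p : Fin (nSeq (2 * j + 1)) → ℕ),
    (∀ i, 1 ≤ js i ∧ IsTypeIEven S (js i) (φ i)) ∧
    (∀ h : 0 < nSeq (2 * j + 1),
      Even (js ⟨0, h⟩) ∧ nSeq (2 * j + 1) ^ 2 < mSeq (2 * js ⟨0, h⟩)) ∧
    StrictMono p ∧
    ∀ (i : ℕ) (h : i + 1 < nSeq (2 * j + 1)),
      (List.ofFn fun k => CodeEntry.mk (φ k) (mSeq (2 * js k)) (p k)).take (i + 1) ∈ QsOmega1 ϱ ∧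
      mSeq (2 * js ⟨i + 1, h⟩) = mSeq (σ.rho ϱ
        ((List.ofFn fun k => CodeEntry.mk (φ k) (mSeq (2 * js k)) (p k)).take (i + 1)))

/-- The four closure conditions that define the norming set. -/
structure IsNormingFamily (ϱ : RhoFunction) (σ : Coding) (S : Set (Omega1 →₀ ℚ)) : Prop where
  single_mem : ∀ α, Finsupp.single α 1 ∈ S
  neg_mem : ∀ φ ∈ S, -φ ∈ S
  restrict_mem : ∀ φ ∈ S, ∀ I : Set Omega1, I.OrdConnected → restrict I φ ∈ S
  even_mem : ∀ j, 1 ≤ j → ∀ φ : Fin (nSeq (2 * j)) → Omega1 →₀ ℚ,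
    (∀ i, φ i ∈ S) → Successive φ → (mSeq (2 * j) : ℚ)⁻¹ • ∑ i, φ i ∈ S
  special_mem : ∀ j, 1 ≤ j → ∀ φ : Fin (nSeq (2 * j + 1)) → Omega1 →₀ ℚ,
    IsSpecial ϱ σ S j φ → (mSeq (2 * j + 1) : ℚ)⁻¹ • ∑ i, φ i ∈ S
  convex : Convex ℚ S

/-- The norming set `K_{ω₁}`: the least set that satisfies the closure conditions
(see `normingSet_isNormingFamily`). -/
def normingSet (ϱ : RhoFunction) (σ : Coding) : Set (Omega1 →₀ ℚ) :=
  ⋂₀ {S | IsNormingFamily ϱ σ S}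

lemma IsTypeIEven.mono {S T : Set (Omega1 →₀ ℚ)} (h : S ⊆ T) {j : ℕ} {φ : Omega1 →₀ ℚ}
    (hφ : IsTypeIEven S j φ) : IsTypeIEven T j φ := by
  obtain ⟨f, I, h1, h2⟩ := hφ
  exact ⟨f, I, fun i => h (h1 i), h2⟩

lemma IsSpecial.mono {ϱ : RhoFunction} {σ : Coding} {S T : Set (Omega1 →₀ ℚ)} (h : S ⊆ T) {j : ℕ}
    {φ : Fin (nSeq (2 * j + 1)) → Omega1 →₀ ℚ} (hφ : IsSpecial ϱ σ S j φ) :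
    IsSpecial ϱ σ T j φ := by
  obtain ⟨h1, h2, h3, js, p, h4, h5⟩ := hφ
  exact ⟨fun i => h (h1 i), h2, h3, js, p, fun i => ⟨(h4 i).1, (h4 i).2.mono h⟩, h5⟩

theorem normingSet_isNormingFamily (ϱ : RhoFunction) (σ : Coding) :
    IsNormingFamily ϱ σ (normingSet ϱ σ) where
  single_mem α := fun _ hS => hS.single_mem α
  neg_mem φ hφ := fun S hS => hS.neg_mem φ (hφ S hS)
  restrict_mem φ hφ I hI := fun S hS => hS.restrict_mem φ (hφ S hS) I hI
  even_mem j hj φ hφ hs := fun S hS => hS.even_mem j hj φ (fun i => hφ i S hS) hs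
  special_mem j hj φ hφ := fun _ hS =>
    hS.special_mem j hj φ (hφ.mono (Set.sInter_subset_of_mem hS))
  convex := convex_sInter fun _ hS => hS.convex

/-! ### The norm and the spaces -/

/-- `φ(x) = ∑ φ(α) x(α)`. -/
def pairing (φ : Omega1 →₀ ℚ) : (Omega1 →₀ ℝ) →ₗ[ℝ] ℝ :=
  Finsupp.lsum ℝ fun α => (φ α : ℝ) • LinearMap.id

lemma pairing_apply (φ : Omega1 →₀ ℚ) (x : Omega1 →₀ ℝ) :
    pairing φ x = ∑ α ∈ x.support, (φ α : ℝ) * x α := by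
  simp [pairing, Finsupp.sum]

lemma mSeq_pos (j : ℕ) : 1 ≤ mSeq j := by
  induction j using mSeq.induct with
  | case1 => simp [mSeq]
  | case2 => simp [mSeq]
  | case3 j ih => simpa [mSeq] using Nat.one_le_pow _ _ ih

lemma abs_average_le {N : ℕ} (m : ℕ) (hm : 1 ≤ m) (φ : Fin N → Omega1 →₀ ℚ)
    (h1 : ∀ i α, |φ i α| ≤ 1) (hs : Successive φ) (α : Omega1) :
    |((m : ℚ)⁻¹ • ∑ i, φ i) α| ≤ 1 := by
  have hm' : (1 : ℚ) ≤ m := by exact_mod_cast hm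
  have key : |∑ i, φ i α| ≤ 1 := by
    by_cases hex : ∃ i, φ i α ≠ 0
    · obtain ⟨i, hi⟩ := hex
      rw [Finset.sum_eq_single i]
      · exact h1 i α
      · intro k _ hk
        by_contra hne
        rcases lt_or_gt_of_ne hk with h | h
        · exact lt_irrefl _ (hs k i h α (by simpa using hne) α (by simpa using hi))
        · exact lt_irrefl _ (hs i k h α (by simpa using hi) α (by simpa using hne))
      · simp
    · push Not at hex
      simp [hex]
  rw [Finsupp.smul_apply, Finsupp.finsetSum_apply, smul_eq_mul, abs_mul,
    abs_of_nonneg (by positivity : (0 : ℚ) ≤ (m : ℚ)⁻¹)]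
  exact mul_le_one₀ (inv_le_one_of_one_le₀ hm') (abs_nonneg _) key

lemma abs_le_one_of_mem {ϱ : RhoFunction} {σ : Coding} {φ : Omega1 →₀ ℚ}
    (hφ : φ ∈ normingSet ϱ σ) (α : Omega1) : |φ α| ≤ 1 := by
  classical
  have : IsNormingFamily ϱ σ {φ : Omega1 →₀ ℚ | ∀ α, |φ α| ≤ 1} := by
    refine ⟨?_, ?_, ?_, ?_, ?_, ?_⟩
    · intro α β
      rw [Finsupp.single_apply]
      split_ifs <;> simp
    · intro φ hφ α
      simpa using hφ α
    · intro φ hφ I _ α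
      rw [restrict, Finsupp.filter_apply]
      split_ifs
      · exact hφ α
      · simp
    · intro j _ φ hφ hs α
      exact abs_average_le _ (mSeq_pos _) φ hφ hs α
    · intro j _ φ hφ α
      exact abs_average_le _ (mSeq_pos _) φ hφ.1 hφ.2.2.1 α
    · intro φ hφ ψ hψ a b ha hb hab α
      calc |(a • φ + b • ψ) α| ≤ |a * φ α| + |b * ψ α| := by
            simpa using abs_add_le (a * φ α) (b * ψ α)
        _ = a * |φ α| + b * |ψ α| := by rw [abs_mul, abs_mul, abs_of_nonneg ha, abs_of_nonneg hb]
        _ ≤ a * 1 + b * 1 := by gcongr <;> [exact hφ α; exact hψ α]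
        _ = 1 := by simpa using hab
  exact hφ _ this α

/-- `c₀₀(ω₁)`, to be normed by `K_{ω₁}`. -/
def C00 (_ϱ : RhoFunction) (_σ : Coding) : Type 1 := Omega1 →₀ ℝ

instance (ϱ : RhoFunction) (σ : Coding) : AddCommGroup (C00 ϱ σ) :=
  inferInstanceAs (AddCommGroup (Omega1 →₀ ℝ))

instance (ϱ : RhoFunction) (σ : Coding) : Module ℝ (C00 ϱ σ) :=
  inferInstanceAs (Module ℝ (Omega1 →₀ ℝ))

/-- `‖x‖ = sup {φ(x) : φ ∈ K_{ω₁}}`. -/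
def normK (ϱ : RhoFunction) (σ : Coding) (x : Omega1 →₀ ℝ) : ℝ :=
  ⨆ φ : normingSet ϱ σ, pairing φ x

lemma normK_bddAbove (ϱ : RhoFunction) (σ : Coding) (x : Omega1 →₀ ℝ) :
    BddAbove (Set.range fun φ : normingSet ϱ σ => pairing φ x) := by
  refine ⟨∑ α ∈ x.support, |x α|, ?_⟩
  rintro _ ⟨φ, rfl⟩
  simp only [pairing_apply]
  refine Finset.sum_le_sum fun α _ => ?_
  have h1 : |((φ : Omega1 →₀ ℚ) α : ℝ)| ≤ 1 := by exact_mod_cast abs_le_one_of_mem φ.2 α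
  calc ((φ : Omega1 →₀ ℚ) α : ℝ) * x α ≤ |((φ : Omega1 →₀ ℚ) α : ℝ)| * |x α| := by
        rw [← abs_mul]; exact le_abs_self _
    _ ≤ 1 * |x α| := by gcongr
    _ = |x α| := one_mul _

lemma pairing_neg (φ : Omega1 →₀ ℚ) (x : Omega1 →₀ ℝ) : pairing (-φ) x = -pairing φ x := by
  simp [pairing_apply]

lemma abs_pairing_le_normK {ϱ : RhoFunction} {σ : Coding} {φ : Omega1 →₀ ℚ}
    (hφ : φ ∈ normingSet ϱ σ) (x : Omega1 →₀ ℝ) : |pairing φ x| ≤ normK ϱ σ x := by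
  refine abs_le'.2 ⟨le_ciSup (normK_bddAbove ϱ σ x) ⟨φ, hφ⟩, ?_⟩
  rw [← pairing_neg]
  exact le_ciSup (normK_bddAbove ϱ σ x) ⟨-φ, (normingSet_isNormingFamily ϱ σ).neg_mem φ hφ⟩

lemma normK_le {ϱ : RhoFunction} {σ : Coding} {x : Omega1 →₀ ℝ} {c : ℝ}
    (h : ∀ φ ∈ normingSet ϱ σ, pairing φ x ≤ c) : normK ϱ σ x ≤ c := by
  have : Nonempty (normingSet ϱ σ) :=
    ⟨⟨Finsupp.single ⟨0, Ordinal.omega_pos 1⟩ 1,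
      (normingSet_isNormingFamily ϱ σ).single_mem _⟩⟩
  exact ciSup_le fun φ => h φ φ.2

lemma abs_apply_le_normK (ϱ : RhoFunction) (σ : Coding) (x : Omega1 →₀ ℝ) (α : Omega1) :
    |x α| ≤ normK ϱ σ x := by
  classical
  have h := abs_pairing_le_normK ((normingSet_isNormingFamily ϱ σ).single_mem α) x
  rw [pairing_apply] at h
  by_cases hα : α ∈ x.support
  · rw [Finset.sum_eq_single α] at h
    · simpa using h
    · intro β _ hβ
      simp [hβ.symm]
    · exact fun h => (h hα).elim
  · rw [Finsupp.notMem_support_iff.1 hα, abs_zero]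
    exact (abs_nonneg _).trans h

instance (ϱ : RhoFunction) (σ : Coding) : NormedAddCommGroup (C00 ϱ σ) :=
  AddGroupNorm.toNormedAddCommGroup
    { toFun := fun x => normK ϱ σ x
      map_zero' := by
        have : ∀ φ : normingSet ϱ σ, pairing φ (0 : Omega1 →₀ ℝ) = 0 := fun φ => map_zero _
        show normK ϱ σ (0 : Omega1 →₀ ℝ) = 0
        simp [normK]
      add_le' := fun x y => normK_le fun φ hφ => by
        have hadd : pairing φ (x + y : Omega1 →₀ ℝ) = pairing φ x + pairing φ y := map_add _ _ _
        exact hadd.le.trans (add_le_add ((le_abs_self _).trans (abs_pairing_le_normK hφ x))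
          ((le_abs_self _).trans (abs_pairing_le_normK hφ y)))
      neg' := fun x => by
        have key : ∀ y : Omega1 →₀ ℝ, normK ϱ σ (-y) ≤ normK ϱ σ y := fun y =>
          normK_le fun φ hφ => by
            rw [map_neg]
            exact (neg_le_abs _).trans (abs_pairing_le_normK hφ y)
        refine le_antisymm (key x) ?_
        have h := key (-(show Omega1 →₀ ℝ from x))
        rw [neg_neg] at h
        exact h
      eq_zero_of_map_eq_zero' := fun x hx => Finsupp.ext fun α => by
        have h := abs_apply_le_normK ϱ σ x α
        have hx' : normK ϱ σ x = 0 := hx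
        rw [hx'] at h
        exact abs_nonpos_iff.1 h }

lemma norm_def {ϱ : RhoFunction} {σ : Coding} (x : C00 ϱ σ) : ‖x‖ = normK ϱ σ x := rfl

instance (ϱ : RhoFunction) (σ : Coding) : NormedSpace ℝ (C00 ϱ σ) where
  norm_smul_le c x := normK_le fun φ hφ => by
    have hsm : pairing φ (c • x : Omega1 →₀ ℝ) = c * pairing φ x := map_smul _ _ _
    refine hsm.le.trans ((le_abs_self _).trans ?_)
    rw [abs_mul, Real.norm_eq_abs]
    exact mul_le_mul_of_nonneg_left (abs_pairing_le_normK hφ x) (abs_nonneg c)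

/-- The Banach space `𝔛_{ω₁}`. -/
abbrev X (ϱ : RhoFunction) (σ : Coding) : Type 1 := UniformSpace.Completion (C00 ϱ σ)

/-- The basis vector `e_α` of `𝔛_{ω₁}`. -/
def e (ϱ : RhoFunction) (σ : Coding) (α : Omega1) : X ϱ σ :=
  ((show C00 ϱ σ from Finsupp.single α (1 : ℝ) : C00 ϱ σ) : X ϱ σ)

/-- The Banach space `𝔛_α`: the closed linear span of `(e_β)_{β < α}` in `𝔛_{ω₁}`. -/
def XBelow (ϱ : RhoFunction) (σ : Coding) (α : Omega1) : Submodule ℝ (X ϱ σ) :=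
  (Submodule.span ℝ (e ϱ σ '' Set.Iio α)).topologicalClosure

end RhoSpace

end

/-!
A smooth `ϱ`-function is built column by column along the well-order of `ω₁`. Below a countable `a`
one chooses a cofinal path `t : ℕ → ω₁` and puts `F_n^a = {t n} ∪ F_n^{t n}`; the path climbs so
slowly that these sets increase with `n` and that `n - #F_n^a → ∞` (`exists_isRhoColumn`). The
growth condition is preserved by the recursion and implies smoothness.

For the projections, let `F = F_n^l`. The point is `restrict_initial_mem`: restriction to `F` maps
the norming set `K` into `(2 + D) • K` with `D = #F / (n + 1)²`. This form, rather than a bound for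
norms, passes through the `(1/m_{2j}, n_{2j})`-operations, because restriction does not enlarge
supports. For a special functional `m⁻¹ (φ_1 + ⋯ + φ_N)` with parameters `p_i`
(`restrict_initial_special_mem`), take the first `i₀` with `n < p_{i₀}`, or `i₀ = N` if there is
none. The supports of the `φ_i` with `i < i₀` meet `F` in an initial segment, since `ϱ ≤ p_i ≤ n`
there and `F` is closed downwards under `ϱ ≤ n`; so this part is an interval restriction of the
functional itself and lies in `K`.
For `i > i₀` the coding makes the weight of `φ_i` larger than `(n + 1)²`, so that the restriction to
`F` of this part is at most `D` in `ℓ₁`. The term of index `i₀` is handled by induction and divided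
by `m ≥ 2`, whence `1 + m⁻¹ (2 + D) + m⁻¹ D ≤ 2 + D`.

By smoothness the norms of the projections onto `F_n^l`, and onto its intersections with intervals,
are bounded uniformly in `n`; convergence on `𝔛_l` follows by density. For an infinite `α`, not
necessarily a limit, choose a limit `l > α` and order `α` by `ϱ(·, l)` first and by the usual order
second. Every initial segment of this order is a union of two pieces of sets `F_n^l` cut out by
intervals, so the partial sum projections are bounded and the enumeration is a Schauder basis.
-/

/-! ### Existence of a smooth `ϱ`-function -/

namespace RhoSpace

/-- The conditions on a column `r = ϱ(·, a)`, relative to the columns `R b = ϱ(·, b)` for `b < a`: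
the two ultrametric inequalities, finiteness of `F_n^a = {ξ < a : r ξ ≤ n}`, and the growth
condition `n - #F_n^a → ∞`, a strengthening of smoothness that survives the recursion. -/
structure IsRhoColumn {W : Type*} [LinearOrder W] (R : W → W → ℕ) (a : W) (r : W → ℕ) : Prop where
  le_trans : ∀ ξ η, ξ < η → η < a → r ξ ≤ max (R η ξ) (r η)
  le_common : ∀ ξ η, ξ < η → η < a → R η ξ ≤ max (r ξ) (r η)
  finite : ∀ n, {ξ | ξ < a ∧ r ξ ≤ n}.Finite
  slow : ∀ c, ∃ n₀, ∀ n ≥ n₀, {ξ | ξ < a ∧ r ξ ≤ n}.ncard + c ≤ n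

lemma IsRhoColumn.congr {W : Type*} [LinearOrder W] {R R' : W → W → ℕ} {a : W} {r : W → ℕ}
    (h : IsRhoColumn R a r) (hR : ∀ b < a, R b = R' b) : IsRhoColumn R' a r where
  le_trans ξ η h1 h2 := hR η h2 ▸ h.le_trans ξ η h1 h2
  le_common ξ η h1 h2 := hR η h2 ▸ h.le_common ξ η h1 h2
  finite := h.finite
  slow := h.slow

/-- A cofinal path `t` below `a` which climbs so slowly that each step is allowed by the columns
already defined and that the sets `F_n` of its members keep growing slower than `n`. -/
lemma exists_slow_path {W : Type*} [LinearOrder W] {R : W → W → ℕ} {a : W}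
    (h : ∀ b < a, IsRhoColumn R b (R b)) (hc : (Set.Iio a).Countable) (hne : (Set.Iio a).Nonempty) :
    ∃ t : ℕ → W, (∀ n, t n < a) ∧ (∀ ξ < a, ∃ n, ξ ≤ t n) ∧
      (∀ n, t n = t (n + 1) ∨ (t n < t (n + 1) ∧ R (t (n + 1)) (t n) ≤ n + 1)) ∧
      ∀ c, ∃ n₀, ∀ n ≥ n₀, {ξ | ξ < t n ∧ R (t n) ξ ≤ n}.ncard + c ≤ n := by
  obtain ⟨f, hf⟩ := hc.exists_eq_range hne
  have hfa : ∀ n, f n < a := fun n => by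
    have : f n ∈ Set.Iio a := hf ▸ Set.mem_range_self n
    exact this
  set b : ℕ → W := fun n => partialSups f n with hb
  have hba : ∀ n, b n < a := fun n => by
    obtain ⟨j, -, hj⟩ := exists_partialSups_eq f n
    exact hj.trans_lt (hfa j)
  have hmono : Monotone b := (partialSups f).monotone
  have hcof : ∀ ξ < a, ∃ n, ξ ≤ b n := fun ξ hξ => by
    have : ξ ∈ Set.range f := hf ▸ hξ
    obtain ⟨n, rfl⟩ := this
    exact ⟨n, le_partialSups f n⟩
  choose M hM using fun k => (h (b k) (hba k)).slow k
  -- the path may reach `b k` only from time `N k` on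
  set N : ℕ → ℕ := fun k => k + ∑ i ∈ Finset.range (k + 1), (M i + R (b i) (b (i - 1))) with hN
  have hNsucc : ∀ k, N k + 1 + (M (k + 1) + R (b (k + 1)) (b k)) = N (k + 1) := fun k => by
    simp only [hN]
    rw [Finset.sum_range_succ _ (k + 1)]
    simp only [Nat.add_sub_cancel]
    ring
  have hkN : ∀ k, k ≤ N k := fun k => Nat.le_add_right _ _
  have hMN : ∀ k, M k ≤ N k := fun k => by
    have := Finset.single_le_sum (f := fun i => M i + R (b i) (b (i - 1)))
      (fun _ _ => Nat.zero_le _) (Finset.self_mem_range_succ k)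
    simp only [hN]
    omega
  set K : ℕ → ℕ := fun n => Nat.findGreatest (fun k => N k ≤ n) n with hK
  have hKge : ∀ k n, N k ≤ n → k ≤ K n := fun k n hkn =>
    Nat.le_findGreatest ((hkN k).trans hkn) hkn
  have hKspec : ∀ k n, N k ≤ n → N (K n) ≤ n := fun k n hkn =>
    Nat.findGreatest_spec (P := fun k => N k ≤ n) ((hkN k).trans hkn) hkn
  have hKmono : ∀ n, K n ≤ K (n + 1) := fun n =>
    Nat.findGreatest_mono (fun k (hk : N k ≤ n) => hk.trans n.le_succ) n.le_succ
  refine ⟨fun n => b (K n), fun n => hba _, fun ξ hξ => ?_, fun n => ?_, fun c => ?_⟩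
  · obtain ⟨k, hk⟩ := hcof ξ hξ
    exact ⟨N k, hk.trans (hmono (hKge k _ le_rfl))⟩
  · rcases Nat.eq_zero_or_pos (K (n + 1)) with h0 | hpos
    · left
      have := hKmono n
      simp only
      rw [show K n = K (n + 1) by omega]
    · obtain ⟨k, hk⟩ := Nat.exists_eq_succ_of_ne_zero hpos.ne'
      have hNk : N (k + 1) ≤ n + 1 := by
        have : N (K (n + 1)) ≤ n + 1 :=
          Nat.findGreatest_of_ne_zero (P := fun k => N k ≤ n + 1) rfl hpos.ne'
        rwa [hk] at this
      have hkn : N k ≤ n := by have := hNsucc k; omega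
      have h1 := hKge k n hkn
      have h2 := hKmono n
      rcases Nat.lt_or_ge k (K n) with hlt | hge
      · left
        simp only
        rw [show K n = K (n + 1) by omega]
      · have hKn : K n = k := le_antisymm hge h1
        simp only
        rw [hk, hKn]
        rcases (hmono k.le_succ).eq_or_lt with heq | hlt
        · exact Or.inl heq
        · refine Or.inr ⟨hlt, ?_⟩
          have := hNsucc k
          show R (b (k + 1)) (b k) ≤ n + 1
          omega
  · refine ⟨N c, fun n hn => ?_⟩
    have h1 := hM (K n) n ((hMN _).trans (hKspec c n hn))
    have h2 := hKge c n hn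
    simp only at h1 ⊢
    omega

/-- The recursion step: the new column is given by `F_n^a = {t n} ∪ F_n^{t n}`, where `t` is a
slow cofinal path below `a`. -/
lemma exists_isRhoColumn {W : Type*} [LinearOrder W] {R : W → W → ℕ} {a : W}
    (h : ∀ b < a, IsRhoColumn R b (R b)) (hc : (Set.Iio a).Countable) :
    ∃ r, IsRhoColumn R a r := by
  classical
  rcases (Set.Iio a).eq_empty_or_nonempty with he | hne
  · have hlt : ∀ ξ, ¬ ξ < a := fun ξ hξ => (he ▸ hξ : ξ ∈ (∅ : Set W))
    refine ⟨0, fun ξ η _ h2 => (hlt η h2).elim, fun ξ η _ h2 => (hlt η h2).elim, fun n => ?_,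
      fun c => ⟨c, fun n hn => ?_⟩⟩ <;> simp [hlt]
    exact hn
  obtain ⟨t, hta, hcof, hstep, hslow⟩ := exists_slow_path h hc hne
  let F : ℕ → Set W := fun n => insert (t n) {ξ | ξ < t n ∧ R (t n) ξ ≤ n}
  have hFsucc : ∀ n, F n ⊆ F (n + 1) := by
    rintro n ξ (rfl | ⟨h1, h2⟩)
    · rcases hstep n with heq | hlt
      · exact Or.inl heq
      · exact Or.inr hlt
    · rcases hstep n with heq | hlt
      · exact Or.inr ⟨heq ▸ h1, heq ▸ h2.trans n.le_succ⟩
      · refine Or.inr ⟨h1.trans hlt.1, ((h _ (hta _)).le_trans ξ _ h1 hlt.1).trans ?_⟩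
        exact max_le (h2.trans n.le_succ) hlt.2
  have hFmono : Monotone F := monotone_nat_of_le_succ hFsucc
  have hFex : ∀ ξ < a, ∃ n, ξ ∈ F n := fun ξ hξ => by
    obtain ⟨n, hn⟩ := hcof ξ hξ
    rcases hn.eq_or_lt with rfl | hlt
    · exact ⟨n, Or.inl rfl⟩
    · set k := max n (R (t n) ξ)
      have hk : t n ∈ F k := hFmono (le_max_left _ _) (Or.inl rfl)
      have hRk : R (t n) ξ ≤ k := le_max_right _ _
      refine ⟨k, ?_⟩
      rcases hk with heq | ⟨h1, h2⟩
      · exact Or.inr ⟨heq ▸ hlt, heq ▸ hRk⟩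
      · exact Or.inr ⟨hlt.trans h1, ((h _ (hta _)).le_trans ξ _ hlt h1).trans (max_le hRk h2)⟩
  have hFlt : ∀ n, ∀ ξ ∈ F n, ξ < a := by
    rintro n ξ (rfl | ⟨h1, -⟩)
    exacts [hta n, h1.trans (hta n)]
  let r : W → ℕ := fun ξ => if hξ : ∃ n, ξ ∈ F n then Nat.find hξ else 0
  have hr : ∀ ξ < a, ∀ n, r ξ ≤ n ↔ ξ ∈ F n := fun ξ hξ n => by
    simp only [r, dif_pos (hFex ξ hξ)]
    exact ⟨fun hn => hFmono hn (Nat.find_spec (hFex ξ hξ)), fun hn => Nat.find_min' _ hn⟩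
  have hset : ∀ n, {ξ | ξ < a ∧ r ξ ≤ n} = F n := fun n => by
    ext ξ
    exact ⟨fun hξ => (hr ξ hξ.1 n).1 hξ.2, fun hξ => ⟨hFlt n ξ hξ, (hr ξ (hFlt n ξ hξ) n).2 hξ⟩⟩
  refine ⟨r, fun ξ η h1 h2 => ?_, fun ξ η h1 h2 => ?_, fun n => ?_, fun c => ?_⟩
  · rw [hr ξ (h1.trans h2)]
    obtain ⟨n, hn'⟩ : ∃ n, n = max (R η ξ) (r η) := ⟨_, rfl⟩
    rw [← hn']
    have hn : R η ξ ≤ n := hn' ▸ le_max_left _ _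
    rcases (hr η h2 n).1 (hn' ▸ le_max_right _ _) with rfl | ⟨h3, h4⟩
    · exact Or.inr ⟨h1, hn⟩
    · exact Or.inr ⟨h1.trans h3, ((h _ (hta n)).le_trans ξ η h1 h3).trans (max_le hn h4)⟩
  · obtain ⟨n, hn⟩ : ∃ n, n = max (r ξ) (r η) := ⟨_, rfl⟩
    rw [← hn]
    have hξ := (hr ξ (h1.trans h2) n).1 (hn ▸ le_max_left _ _)
    rcases (hr η h2 n).1 (hn ▸ le_max_right _ _) with rfl | ⟨h3, h4⟩
    · rcases hξ with heq | hlt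
      · exact (h1.ne heq).elim
      · exact hlt.2
    · rcases hξ with heq | hlt
      · exact (lt_asymm h1 (heq ▸ h3)).elim
      · exact ((h _ (hta n)).le_common ξ η h1 h3).trans (max_le hlt.2 h4)
  · rw [hset]
    exact ((h _ (hta n)).finite n).insert _
  · obtain ⟨n₀, hn₀⟩ := hslow (c + 1)
    refine ⟨n₀, fun n hn => ?_⟩
    rw [hset]
    have := hn₀ n hn
    have := Set.ncard_insert_le (t n) {ξ | ξ < t n ∧ R (t n) ξ ≤ n}
    simp only [F]
    omega

/-- All columns can be chosen coherently, by well-founded recursion. -/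
lemma exists_isRhoColumn_family {W : Type*} [LinearOrder W] [WellFoundedLT W]
    (hc : ∀ a : W, (Set.Iio a).Countable) : ∃ R : W → W → ℕ, ∀ a, IsRhoColumn R a (R a) := by
  classical
  let ext (a : W) (rec : ∀ b, b < a → W → ℕ) : W → W → ℕ :=
    fun b => if h : b < a then rec b h else 0
  let step (a : W) (rec : ∀ b, b < a → W → ℕ) : W → ℕ :=
    if h : ∃ r, IsRhoColumn (ext a rec) a r then h.choose else 0
  let R : W → W → ℕ := (wellFounded_lt (α := W)).fix step
  have hR : ∀ a, R a = step a fun b _ => R b := fun a => WellFounded.fix_eq _ _ a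
  refine ⟨R, fun a => ?_⟩
  induction a using WellFoundedLT.induction with
  | ind a ih =>
    have hext : ∀ b < a, R b = ext a (fun b _ => R b) b := fun b hb => by simp [ext, hb]
    obtain ⟨r, hr⟩ := exists_isRhoColumn ih (hc a)
    have hex : ∃ r, IsRhoColumn (ext a fun b _ => R b) a r := ⟨r, hr.congr hext⟩
    have hRa : R a = hex.choose := by rw [hR]; exact dif_pos hex
    rw [hRa]
    exact hex.choose_spec.congr fun b hb => (hext b hb).symm

lemma countable_Iio_omega1 (a : Omega1) : (Set.Iio a).Countable := by
  have h : (Set.Iio (a : Ordinal.{0})).Countable := by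
    rw [← Cardinal.le_aleph0_iff_set_countable, Cardinal.mk_Iio_ordinal, Cardinal.lift_le_aleph0,
      ← Cardinal.lt_aleph_one_iff]
    exact Cardinal.lt_omega_iff_card_lt.1 a.2
  exact h.preimage Subtype.val_injective

lemma RhoFunction.mem_initial {ϱ : RhoFunction} {α β : Omega1} {n : ℕ} :
    α ∈ ϱ.initial β n ↔ α < β ∧ ϱ.toFun α β ≤ n := by
  simp [RhoFunction.initial]

theorem exists_isSmooth : ∃ ϱ : RhoFunction, ϱ.IsSmooth := by
  obtain ⟨R, hR⟩ := exists_isRhoColumn_family countable_Iio_omega1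
  let ϱ : RhoFunction :=
    { toFun := fun α β => R β α
      le_max_trans := fun α β γ h1 h2 => (hR γ).le_trans α β h1 h2
      le_max_common := fun α β γ h1 h2 => (hR γ).le_common α β h1 h2
      finite_le := fun β n => (hR β).finite n }
  refine ⟨ϱ, fun l _ => ?_⟩
  obtain ⟨n₀, hn₀⟩ := (hR l).slow 0
  have hcard : ∀ n ≥ n₀, (ϱ.initial l n).card ≤ n := fun n hn => by
    rw [RhoFunction.initial, ← Set.ncard_eq_toFinset_card _ (ϱ.finite_le l n)]
    simpa using hn₀ n hn
  -- below `n₀` the sets `F_n` are contained in `F_{n₀}`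
  refine ⟨max 1 n₀, ?_⟩
  rintro _ ⟨n, rfl⟩
  have hn1 : (1 : ℝ) ≤ (n : ℕ) := by exact_mod_cast n.pos
  have hn : (0 : ℝ) < (n : ℕ) := zero_lt_one.trans_le hn1
  rw [div_le_iff₀ hn]
  rcases le_total n₀ (n : ℕ) with h | h
  · have : ((ϱ.initial l n).card : ℝ) ≤ (n : ℕ) := by exact_mod_cast hcard _ h
    refine this.trans (le_mul_of_one_le_left hn.le (le_max_left _ _))
  · have h1 : (ϱ.initial l n).card ≤ n₀ := by
      refine (Finset.card_le_card fun α hα => ?_).trans (hcard n₀ le_rfl)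
      rw [RhoFunction.mem_initial] at hα ⊢
      exact ⟨hα.1, hα.2.trans h⟩
    have h2 : ((ϱ.initial l n).card : ℝ) ≤ n₀ := by exact_mod_cast h1
    refine (h2.trans (le_max_right (1 : ℝ) n₀)).trans (le_mul_of_one_le_right ?_ hn1)
    exact zero_le_one.trans (le_max_left _ _)

end RhoSpace

/-! ### The norming set and the finite sets `F_n^l` -/

namespace RhoSpace

open scoped Pointwise

lemma restrict_apply_of_mem {I : Set Omega1} {α : Omega1} (h : α ∈ I) (φ : Omega1 →₀ ℚ) :
    restrict I φ α = φ α := by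
  classical
  exact Finsupp.filter_apply_pos _ _ h

lemma restrict_apply_of_notMem {I : Set Omega1} {α : Omega1} (h : α ∉ I) (φ : Omega1 →₀ ℚ) :
    restrict I φ α = 0 := by
  classical
  exact Finsupp.filter_apply_neg _ _ h

lemma abs_restrict_apply_le (I : Set Omega1) (φ : Omega1 →₀ ℚ) (α : Omega1) :
    |restrict I φ α| ≤ |φ α| := by
  by_cases h : α ∈ I
  · rw [restrict_apply_of_mem h]
  · rw [restrict_apply_of_notMem h, abs_zero]
    exact abs_nonneg _

lemma restrict_congr {I J : Set Omega1} {φ : Omega1 →₀ ℚ}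
    (h : ∀ α ∈ φ.support, α ∈ I ↔ α ∈ J) : restrict I φ = restrict J φ := by
  ext α
  by_cases hα : α ∈ φ.support
  · by_cases hI : α ∈ I
    · rw [restrict_apply_of_mem hI, restrict_apply_of_mem ((h α hα).1 hI)]
    · rw [restrict_apply_of_notMem hI, restrict_apply_of_notMem (mt (h α hα).2 hI)]
  · have h0 : φ α = 0 := Finsupp.notMem_support_iff.1 hα
    have key : ∀ I, restrict I φ α = 0 := fun I =>
      abs_nonpos_iff.1 ((abs_restrict_apply_le I φ α).trans (by simp [h0]))
    rw [key, key]

lemma restrict_eq_self {I : Set Omega1} {φ : Omega1 →₀ ℚ} (h : ∀ α ∈ φ.support, α ∈ I) :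
    restrict I φ = φ := by
  classical
  exact Finsupp.filter_eq_self_iff _ _ |>.2 fun α hα => h α (Finsupp.mem_support_iff.2 hα)

lemma restrict_empty (φ : Omega1 →₀ ℚ) : restrict ∅ φ = 0 :=
  Finsupp.ext fun _ => restrict_apply_of_notMem (Set.notMem_empty _) φ

lemma restrict_restrict (I J : Set Omega1) (φ : Omega1 →₀ ℚ) :
    restrict I (restrict J φ) = restrict (I ∩ J) φ := by
  ext α
  by_cases hI : α ∈ I
  · by_cases hJ : α ∈ J
    · rw [restrict_apply_of_mem hI, restrict_apply_of_mem hJ, restrict_apply_of_mem (I := I ∩ J) ⟨hI, hJ⟩]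
    · rw [restrict_apply_of_mem hI, restrict_apply_of_notMem hJ,
        restrict_apply_of_notMem (I := I ∩ J) fun h => hJ h.2]
  · rw [restrict_apply_of_notMem hI, restrict_apply_of_notMem (I := I ∩ J) fun h => hI h.1]

lemma restrict_add (I : Set Omega1) (φ ψ : Omega1 →₀ ℚ) :
    restrict I (φ + ψ) = restrict I φ + restrict I ψ := by
  classical
  exact Finsupp.filter_add

lemma restrict_smul (I : Set Omega1) (c : ℚ) (φ : Omega1 →₀ ℚ) :
    restrict I (c • φ) = c • restrict I φ := by
  classical
  exact Finsupp.filter_smul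

lemma restrict_neg (I : Set Omega1) (φ : Omega1 →₀ ℚ) :
    restrict I (-φ) = -restrict I φ := by
  simpa using restrict_smul I (-1) φ

lemma restrict_sum (I : Set Omega1) {ι : Type*} (s : Finset ι) (φ : ι → Omega1 →₀ ℚ) :
    restrict I (∑ i ∈ s, φ i) = ∑ i ∈ s, restrict I (φ i) := by
  classical
  induction s using Finset.induction_on with
  | empty => simpa using restrict_smul I 0 0
  | insert a s ha ih => rw [Finset.sum_insert ha, Finset.sum_insert ha, restrict_add, ih]

lemma Successive.mono {N : ℕ} {φ ψ : Fin N → Omega1 →₀ ℚ} (h : Successive φ)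
    (hs : ∀ i, (ψ i).support ⊆ (φ i).support) : Successive ψ :=
  fun i k hik a ha b hb => h i k hik a (hs i ha) b (hs k hb)

lemma support_restrict_subset (I : Set Omega1) (φ : Omega1 →₀ ℚ) :
    (restrict I φ).support ⊆ φ.support := by
  intro α hα
  rw [Finsupp.mem_support_iff] at hα ⊢
  intro h
  exact hα (abs_nonpos_iff.1 ((abs_restrict_apply_le I φ α).trans (by simp [h])))

section Multiples

variable {ϱ : RhoFunction} {σ : Coding}

lemma zero_mem_normingSet : (0 : Omega1 →₀ ℚ) ∈ normingSet ϱ σ := by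
  have h := normingSet_isNormingFamily ϱ σ
  rw [← restrict_empty (Finsupp.single ⟨0, Ordinal.omega_pos 1⟩ 1)]
  exact h.restrict_mem _ (h.single_mem _) ∅ Set.ordConnected_empty

lemma add_mem_smul_normingSet {a b : ℚ} (ha : 0 ≤ a) (hb : 0 ≤ b) {φ ψ : Omega1 →₀ ℚ}
    (hφ : φ ∈ a • normingSet ϱ σ) (hψ : ψ ∈ b • normingSet ϱ σ) :
    φ + ψ ∈ (a + b) • normingSet ϱ σ := by
  rw [(normingSet_isNormingFamily ϱ σ).convex.add_smul ha hb]
  exact Set.add_mem_add hφ hψ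

lemma mem_smul_normingSet_of_le {a b : ℚ} (ha : 0 ≤ a) (hab : a ≤ b) {φ : Omega1 →₀ ℚ}
    (hφ : φ ∈ a • normingSet ϱ σ) : φ ∈ b • normingSet ϱ σ := by
  have h : (0 : Omega1 →₀ ℚ) ∈ (b - a) • normingSet ϱ σ :=
    ⟨0, zero_mem_normingSet, smul_zero _⟩
  simpa using add_mem_smul_normingSet ha (sub_nonneg.2 hab) hφ h

lemma smul_mem_smul_normingSet (c : ℚ) {a : ℚ} {φ : Omega1 →₀ ℚ}
    (hφ : φ ∈ a • normingSet ϱ σ) : c • φ ∈ (c * a) • normingSet ϱ σ := by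
  obtain ⟨ψ, hψ, rfl⟩ := hφ
  exact ⟨ψ, hψ, mul_smul c a ψ⟩

lemma restrict_mem_smul_normingSet {a : ℚ} {φ : Omega1 →₀ ℚ} (hφ : φ ∈ a • normingSet ϱ σ)
    {I : Set Omega1} (hI : I.OrdConnected) : restrict I φ ∈ a • normingSet ϱ σ := by
  obtain ⟨ψ, hψ, rfl⟩ := hφ
  exact ⟨_, (normingSet_isNormingFamily ϱ σ).restrict_mem ψ hψ I hI, (restrict_smul I a ψ).symm⟩

lemma single_mem_smul_normingSet (α : Omega1) {c t : ℚ} (hc : |c| ≤ t) :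
    Finsupp.single α c ∈ t • normingSet ϱ σ := by
  have h := normingSet_isNormingFamily ϱ σ
  refine mem_smul_normingSet_of_le (abs_nonneg c) hc ?_
  rcases abs_choice c with hc | hc <;> rw [hc]
  · exact ⟨_, h.single_mem α, by simp⟩
  · exact ⟨_, h.neg_mem _ (h.single_mem α), by simp⟩

/-- The norming set contains the unit ball of `ℓ₁`, so a functional with small values on a finite
set belongs to a small multiple of it. -/
lemma mem_smul_normingSet_of_abs_le {F : Finset Omega1} {t : ℚ} (ht : 0 ≤ t) {φ : Omega1 →₀ ℚ}
    (hF : φ.support ⊆ F) (hφ : ∀ α, |φ α| ≤ t) : φ ∈ (F.card * t) • normingSet ϱ σ := by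
  classical
  have key : ∀ s : Finset Omega1,
      ∑ α ∈ s, Finsupp.single α (φ α) ∈ (s.card * t) • normingSet ϱ σ := by
    intro s
    induction s using Finset.induction_on with
    | empty => exact ⟨0, zero_mem_normingSet, by simp⟩
    | insert a s ha ih =>
      rw [Finset.sum_insert ha, Finset.card_insert_of_notMem ha, Nat.cast_succ, add_one_mul,
        add_comm _ t]
      exact add_mem_smul_normingSet ht (by positivity) (single_mem_smul_normingSet a (hφ a)) ih
  have h := key F
  have hsum : ∑ α ∈ F, Finsupp.single α (φ α) = φ := by
    conv_rhs => rw [← Finsupp.sum_single φ]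
    exact (Finsupp.sum_of_support_subset φ hF _ (by simp)).symm
  rwa [hsum] at h

end Multiples

/-! ### Special sequences and the sets `F_n^l` -/

lemma self_le_mSeq (j : ℕ) : j ≤ mSeq j := by
  induction j using mSeq.induct with
  | case1 => simp
  | case2 => simp [mSeq]
  | case3 j ih =>
    have h1 : 2 ≤ mSeq (j + 1) := by
      cases j with
      | zero => simp [mSeq]
      | succ j => omega
    calc j + 2 ≤ mSeq (j + 1) * 2 := by omega
      _ ≤ mSeq (j + 1) * mSeq (j + 1) ^ 3 := by
        gcongr
        calc 2 ≤ 2 ^ 3 := by norm_num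
          _ ≤ mSeq (j + 1) ^ 3 := by gcongr
      _ = mSeq (j + 2) := by rw [mSeq]; ring

lemma RhoFunction.le_maxOn {ϱ : RhoFunction} {F : Finset Omega1} {α β : Omega1} (hα : α ∈ F)
    (hβ : β ∈ F) (h : α < β) : ϱ.toFun α β ≤ ϱ.maxOn F := by
  classical
  exact Finset.le_sup (f := fun q : Omega1 × Omega1 => ϱ.toFun q.1 q.2) (b := (α, β))
    (by simp [hα, hβ, h])

lemma Coding.param_sq_lt_rho (σ : Coding) {ϱ : RhoFunction} {Φ : List (CodeEntry Omega1)}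
    (hΦ : Φ ∈ QsOmega1 ϱ) (h : Φ ≠ []) : (Φ.getLast h).param ^ 2 < σ.rho ϱ Φ := by
  have hne : collapseCode ϱ Φ ≠ [] := by simpa [collapseCode] using h
  have := σ.param_sq_lt _ (collapseCode_mem_Qs ϱ hΦ) hne
  simpa [Coding.rho, collapseCode, List.getLast_map] using this

lemma IsTypeIEven.abs_apply_le {S : Set (Omega1 →₀ ℚ)} (hS : ∀ φ ∈ S, ∀ α, |φ α| ≤ 1) {j : ℕ}
    {φ : Omega1 →₀ ℚ} (h : IsTypeIEven S j φ) (α : Omega1) :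
    |φ α| ≤ (mSeq (2 * j) : ℚ)⁻¹ := by
  obtain ⟨f, I, hf, hs, -, hφ⟩ := h
  have key : |restrict I ((mSeq (2 * j) : ℚ)⁻¹ • ∑ i, f i) α| ≤ (mSeq (2 * j) : ℚ)⁻¹ := by
    refine (abs_restrict_apply_le _ _ _).trans ?_
    have h1 := abs_average_le 1 le_rfl f (fun i => hS _ (hf i)) hs α
    rw [Nat.cast_one, inv_one, one_smul] at h1
    rw [Finsupp.smul_apply, smul_eq_mul, abs_mul, abs_of_nonneg (by positivity)]
    exact mul_le_of_le_one_right (by positivity) h1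
  rcases hφ with rfl | rfl
  · exact key
  · simpa using key

lemma sum_abs_le_of_successive {N : ℕ} {φ : Fin N → Omega1 →₀ ℚ} {t : ℚ} (ht : 0 < t)
    (hφ : ∀ i α, |φ i α| ≤ t) (hs : Successive φ) (α : Omega1) : |(∑ i, φ i) α| ≤ t := by
  have h := abs_average_le 1 le_rfl (fun i => t⁻¹ • φ i) (fun i α => ?_) (hs.mono fun i =>
    Finsupp.support_smul) α
  · rw [← Finset.smul_sum, Nat.cast_one, inv_one, one_smul, Finsupp.smul_apply, smul_eq_mul,
      abs_mul, abs_of_pos (inv_pos.2 ht), inv_mul_le_iff₀ ht, mul_one] at h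
    exact h
  · rw [Finsupp.smul_apply, smul_eq_mul, abs_mul, abs_of_pos (inv_pos.2 ht), inv_mul_le_iff₀ ht,
      mul_one]
    exact hφ i α

/-- What the proof uses of a special sequence: unless `k` is the last index, `ϱ(α, β)`
is at most `p_k` for `β` in the support of `φ_k` and `α < β` in that of some `φ_i`, `i ≤ k`; and
the values of all later functionals are at most `1 / p_k²`. -/
lemma IsSpecial.exists_params {ϱ : RhoFunction} {σ : Coding} {j : ℕ}
    {φ : Fin (nSeq (2 * j + 1)) → Omega1 →₀ ℚ} (h : IsSpecial ϱ σ (normingSet ϱ σ) j φ) :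
    ∃ p : Fin (nSeq (2 * j + 1)) → ℕ, StrictMono p ∧
      (∀ i k : Fin (nSeq (2 * j + 1)), i ≤ k → (k : ℕ) + 1 < nSeq (2 * j + 1) → ∀ α ∈ (φ i).support, ∀ β ∈ (φ k).support,
        α < β → ϱ.toFun α β ≤ p k) ∧
      ∀ i k, i < k → 0 < p i → ∀ α, |φ k α| ≤ ((p i : ℚ) ^ 2)⁻¹ := by
  obtain ⟨-, -, -, js, p, htype, -, hp, hcode⟩ := h
  refine ⟨p, hp, fun i k hik hk α hα β hβ hαβ => ?_, fun i k hik hi α => ?_⟩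
  · have hQ := (hcode k hk).1
    set L := List.ofFn fun k => CodeEntry.mk (φ k) (mSeq (2 * js k)) (p k) with hL
    have hlen : (k : ℕ) < (L.take (k + 1)).length := by simp [hL]
    have h1 := hQ.2 k hlen
    rw [List.take_take, min_self] at h1
    have hmem : ∀ i ≤ k, (CodeEntry.mk (φ i) (mSeq (2 * js i)) (p i)) ∈ L.take (k + 1) := by
      intro i hi
      rw [List.mem_take_iff_getElem]
      exact ⟨i, by simp [hL]; omega, by simp [hL]⟩
    have h2 := RhoFunction.le_maxOn (ϱ := ϱ) (mem_codeSupport.2 ⟨_, hmem i hik, hα⟩)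
      (mem_codeSupport.2 ⟨_, hmem k le_rfl, hβ⟩) hαβ
    refine h2.trans (h1.trans (le_of_eq ?_))
    simp [hL]
  · obtain ⟨k, hk⟩ := k
    obtain ⟨k, rfl⟩ : ∃ l, k = l + 1 :=
      ⟨k - 1, by have : (i : ℕ) < k := hik; omega⟩
    have hik' : i ≤ ⟨k, by omega⟩ := by
      have : (i : ℕ) < k + 1 := hik
      exact Fin.le_def.2 (by simp only; omega)
    obtain ⟨hQ, hw⟩ := hcode k hk
    refine ((htype _).2.abs_apply_le (fun φ hφ => abs_le_one_of_mem hφ) α).trans ?_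
    have h1 := σ.param_sq_lt_rho hQ hQ.1.ne_nil
    have h2 : p i ^ 2 ≤ mSeq (2 * js ⟨k + 1, hk⟩) := by
      rw [hw]
      refine le_trans ?_ (h1.le.trans (self_le_mSeq _))
      refine Nat.pow_le_pow_left ((hp.monotone hik').trans (le_of_eq ?_)) 2
      simp [List.getLast_eq_getElem, hk.le]
    gcongr
    exact_mod_cast h2

/-- The effect of `F = F_n^l` on a special functional. Up to the first index `i₀` with `n < p_{i₀}`
the set `F` cuts the supports in an initial segment, because `F` is closed under `ϱ ≤ n`; after
`i₀` the weights are so large that what remains on `F` is small in `ℓ₁`. Only the restriction of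
`φ_{i₀}` itself needs the inductive hypothesis `hφ`. -/
lemma restrict_initial_special_mem {ϱ : RhoFunction} {σ : Coding} (l : Omega1) (n : ℕ) {j : ℕ}
    (hj : 1 ≤ j) {φ : Fin (nSeq (2 * j + 1)) → Omega1 →₀ ℚ}
    (h : IsSpecial ϱ σ (normingSet ϱ σ) j φ) {D : ℚ}
    (hD : D = (ϱ.initial l n).card * (((n + 1 : ℕ) : ℚ) ^ 2)⁻¹)
    (hφ : ∀ i, restrict (ϱ.initial l n) (φ i) ∈ (2 + D) • normingSet ϱ σ) :
    restrict (ϱ.initial l n) ((mSeq (2 * j + 1) : ℚ)⁻¹ • ∑ i, φ i) ∈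
      (2 + D) • normingSet ϱ σ := by
  classical
  obtain ⟨p, hp, hrho, hsmall⟩ := h.exists_params
  have hs := h.2.2.1
  set F := ϱ.initial l n
  have hD0 : 0 ≤ D := hD ▸ by positivity
  have hK := normingSet_isNormingFamily ϱ σ
  have hm : (2 : ℚ) ≤ mSeq (2 * j + 1) := by
    have := self_le_mSeq (2 * j + 1)
    exact_mod_cast (by omega : 2 ≤ mSeq (2 * j + 1))
  set m : ℚ := (mSeq (2 * j + 1) : ℚ)
  have hm2 : m⁻¹ ≤ 1 / 2 := by
    rw [← one_div]
    exact one_div_le_one_div_of_le two_pos hm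
  rcases Nat.eq_zero_or_pos (nSeq (2 * j + 1)) with hN | hN
  · have : IsEmpty (Fin (nSeq (2 * j + 1))) := by rw [hN]; infer_instance
    rw [Finset.univ_eq_empty, Finset.sum_empty, smul_zero, restrict_eq_self (by simp)]
    exact ⟨0, zero_mem_normingSet, smul_zero _⟩
  -- the last index is admitted as `i₀`, whatever its parameter: a special sequence imposes no
  -- relation between `ϱ` and the last parameter
  obtain ⟨i₀, hi₀, hmin⟩ : ∃ i₀, (n < p i₀ ∨ ∀ k, k ≤ i₀) ∧
      ∀ i < i₀, ¬ (n < p i ∨ ∀ k, k ≤ i) := by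
    obtain ⟨i₀, h1, h2⟩ := wellFounded_lt.has_min
      {i : Fin (nSeq (2 * j + 1)) | n < p i ∨ ∀ k, k ≤ i}
      ⟨⟨nSeq (2 * j + 1) - 1, by omega⟩, Or.inr fun k => Fin.le_def.2 (by simp only; omega)⟩
    exact ⟨i₀, h1, fun i hi h3 => h2 i h3 hi⟩
  have hlow : ∀ i < i₀, p i ≤ n ∧ (i : ℕ) + 1 < nSeq (2 * j + 1) := fun i hi =>
    ⟨not_lt.1 fun h' => hmin i hi (Or.inl h'), by have : (i : ℕ) < i₀ := hi; omega⟩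
  let J : Set Omega1 := {β | ∃ k < i₀, ∃ α ∈ (φ k).support, α ∈ F ∧ β ≤ α}
  have hJ : J.OrdConnected := ⟨fun x _ y ⟨k, hk, α, h1, h2, h3⟩ z hz =>
    ⟨k, hk, α, h1, h2, hz.2.trans h3⟩⟩
  have hJlow : ∀ i < i₀, restrict F (φ i) = restrict J (φ i) := by
    refine fun i hi => restrict_congr fun α hα => ⟨fun hαF => ⟨i, hi, α, hα, hαF, le_rfl⟩, ?_⟩
    rintro ⟨k, hk, β, hβ, hβF, hαβ⟩
    rcases hαβ.eq_or_lt with rfl | hlt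
    · exact hβF
    have hik : i ≤ k := by
      by_contra hki
      exact lt_asymm hlt (hs k i (not_le.1 hki) β hβ α hα)
    have h1 := (hrho i k hik (hlow k hk).2 α hα β hβ hlt).trans (hlow k hk).1
    have h2 := RhoFunction.mem_initial.1 (Finset.mem_coe.1 hβF)
    exact RhoFunction.mem_initial.2 ⟨hlt.trans h2.1,
      (ϱ.le_max_trans α β l hlt h2.1).trans (max_le h1 h2.2)⟩
  have hJhigh : ∀ i, i₀ ≤ i → restrict J (φ i) = 0 := by
    intro i hi
    rw [← restrict_empty (φ i)]
    refine restrict_congr fun α hα => ⟨?_, False.elim⟩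
    rintro ⟨k, hk, β, hβ, -, hαβ⟩
    exact absurd (hs k i (hk.trans_le hi) β hβ α hα) (not_lt.2 hαβ)
  let ψ : Fin (nSeq (2 * j + 1)) → Omega1 →₀ ℚ := fun i => if i₀ < i then restrict F (φ i) else 0
  have hψφ : ∀ i, (ψ i).support ⊆ (φ i).support := fun i => by
    simp only [ψ]
    split_ifs
    · exact support_restrict_subset _ _
    · simp
  have hψF : (∑ i, ψ i).support ⊆ F := by
    intro α hα
    by_contra hαF
    refine Finsupp.mem_support_iff.1 hα ?_
    rw [Finsupp.finsetSum_apply]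
    refine Finset.sum_eq_zero fun i _ => ?_
    simp only [ψ]
    split_ifs
    · exact restrict_apply_of_notMem (by simpa using hαF) _
    · rfl
  have hψle : ∀ i α, |ψ i α| ≤ (((n + 1 : ℕ) : ℚ) ^ 2)⁻¹ := fun i α => by
    simp only [ψ]
    split_ifs with hi
    · have hn : n < p i₀ := hi₀.resolve_right fun hall => absurd (hall i) (not_le.2 hi)
      refine (abs_restrict_apply_le _ _ _).trans
        ((hsmall i₀ i hi (Nat.zero_lt_of_lt hn) α).trans ?_)
      gcongr
      exact hn
    · simp only [Finsupp.coe_zero, Pi.zero_apply, abs_zero]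
      positivity
  have hψmem : ∑ i, ψ i ∈ D • normingSet ϱ σ := by
    rw [hD]
    exact mem_smul_normingSet_of_abs_le (by positivity) hψF
      (sum_abs_le_of_successive (by positivity) hψle (hs.mono hψφ))
  have hsplit : restrict F (m⁻¹ • ∑ i, φ i) =
      restrict J (m⁻¹ • ∑ i, φ i) + m⁻¹ • restrict F (φ i₀) + m⁻¹ • ∑ i, ψ i := by
    rw [restrict_smul, restrict_smul, ← smul_add, ← smul_add, restrict_sum, restrict_sum]
    congr 1
    have h1 : restrict F (φ i₀) = ∑ i, if i = i₀ then restrict F (φ i) else 0 := by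
      simp
    rw [h1, ← Finset.sum_add_distrib, ← Finset.sum_add_distrib]
    refine Finset.sum_congr rfl fun i _ => ?_
    rcases lt_trichotomy i i₀ with hi | rfl | hi
    · simp [ψ, hi.ne, hi.not_gt, hJlow i hi]
    · simp [ψ, hJhigh i le_rfl]
    · simp [ψ, hi.ne', hi, hJhigh i hi.le]
  have hmem : m⁻¹ • ∑ i, φ i ∈ (1 : ℚ) • normingSet ϱ σ := by
    rw [one_smul]
    exact hK.special_mem j hj φ h
  rw [hsplit]
  refine mem_smul_normingSet_of_le (a := 1 + m⁻¹ * (2 + D) + m⁻¹ * D) (by positivity) ?_ <|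
    add_mem_smul_normingSet (by positivity) (by positivity)
      (add_mem_smul_normingSet zero_le_one (by positivity) (restrict_mem_smul_normingSet hmem hJ)
        (smul_mem_smul_normingSet _ (hφ i₀)))
      (smul_mem_smul_normingSet _ hψmem)
  nlinarith

/-- Restriction to `F_n^l` maps the norming set into a multiple of itself. -/
theorem restrict_initial_mem {ϱ : RhoFunction} {σ : Coding} (l : Omega1) (n : ℕ) {D : ℚ}
    (hD : D = (ϱ.initial l n).card * (((n + 1 : ℕ) : ℚ) ^ 2)⁻¹) {φ : Omega1 →₀ ℚ}
    (hφ : φ ∈ normingSet ϱ σ) :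
    restrict (ϱ.initial l n) φ ∈ (2 + D) • normingSet ϱ σ := by
  have hD0 : 0 ≤ D := hD ▸ by positivity
  have hK := normingSet_isNormingFamily ϱ σ
  have hone : ∀ φ ∈ normingSet ϱ σ, φ ∈ (2 + D) • normingSet ϱ σ := fun φ hφ =>
    mem_smul_normingSet_of_le zero_le_one (by linarith) (by rwa [one_smul])
  suffices h : IsNormingFamily ϱ σ {φ | φ ∈ normingSet ϱ σ ∧
      restrict (ϱ.initial l n) φ ∈ (2 + D) • normingSet ϱ σ} from (hφ _ h).2
  refine ⟨fun α => ⟨hK.single_mem α, ?_⟩, fun φ hφ => ⟨hK.neg_mem φ hφ.1, ?_⟩,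
    fun φ hφ I hI => ⟨hK.restrict_mem φ hφ.1 I hI, ?_⟩,
    fun j hj φ hφ hs => ⟨hK.even_mem j hj φ (fun i => (hφ i).1) hs, ?_⟩,
    fun j hj φ h => ?_, fun φ hφ ψ hψ a b ha hb hab => ⟨hK.convex hφ.1 hψ.1 ha hb hab, ?_⟩⟩
  · refine hone _ ?_
    by_cases hα : α ∈ (ϱ.initial l n : Set Omega1)
    · convert hK.single_mem α using 1
      refine restrict_eq_self fun β hβ => ?_
      rw [Finsupp.mem_support_single] at hβ
      exact hβ.1 ▸ hα
    · convert zero_mem_normingSet (ϱ := ϱ) (σ := σ) using 1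
      rw [← restrict_empty]
      exact restrict_congr fun β hβ => by
        rw [Finsupp.mem_support_single] at hβ
        simp [hβ.1, hα]
  · rw [restrict_neg]
    obtain ⟨ψ, hψ, h⟩ := hφ.2
    exact ⟨-ψ, hK.neg_mem ψ hψ, by simp [← h]⟩
  · rw [restrict_restrict, Set.inter_comm, ← restrict_restrict]
    exact restrict_mem_smul_normingSet hφ.2 hI
  · rw [restrict_smul, restrict_sum]
    choose ψ hψ hψφ using fun i => (hφ i).2
    have hC : (2 + D) ≠ 0 := by positivity
    refine ⟨_, hK.even_mem j hj ψ hψ (hs.mono fun i => ?_), ?_⟩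
    · refine Finset.Subset.trans ?_ (support_restrict_subset (ϱ.initial l n) (φ i))
      rw [← hψφ i]
      exact (Finsupp.support_smul_eq hC).ge
    · simp only
      rw [smul_comm, Finset.smul_sum]
      simp only at hψφ
      simp only [hψφ]
  · have h' := h.mono (T := normingSet ϱ σ) fun _ hφ => hφ.1
    exact ⟨hK.special_mem j hj φ h', restrict_initial_special_mem l n hj h' hD fun i => (h.1 i).2⟩
  · rw [restrict_add, restrict_smul, restrict_smul]
    exact (hK.convex.smul (2 + D)) hφ.2 hψ.2 ha hb hab

end RhoSpace

noncomputable section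

/-! ### Finite projections on `𝔛_{ω₁}` -/

namespace RhoSpace

open scoped Pointwise
open Filter Topology

section Projections

variable (ϱ : RhoFunction) (σ : Coding)

/-- The coordinate functional `e_α^*` on `𝔛_{ω₁}`. -/
def coordFunctional (α : Omega1) : X ϱ σ →L[ℝ] ℝ :=
  (LinearMap.mkContinuous (show C00 ϱ σ →ₗ[ℝ] ℝ from Finsupp.lapply α) 1 fun x => by
    rw [one_mul]
    exact abs_apply_le_normK ϱ σ x α).extend UniformSpace.Completion.toComplL

lemma coordFunctional_coe (α : Omega1) (x : C00 ϱ σ) :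
    coordFunctional ϱ σ α (x : X ϱ σ) = (show Omega1 →₀ ℝ from x) α :=
  ContinuousLinearMap.extend_eq _ UniformSpace.Completion.denseRange_coe
    (UniformSpace.Completion.isUniformInducing_coe _) x

open scoped Classical in
lemma coordFunctional_e (α β : Omega1) :
    coordFunctional ϱ σ α (e ϱ σ β) = if β = α then 1 else 0 := by
  rw [e, coordFunctional_coe]
  exact Finsupp.single_apply

/-- The projection `x ↦ ∑_{a ∈ A} e_a^*(x) e_a` for a finite set `A`. -/
def finProj (A : Finset Omega1) : X ϱ σ →L[ℝ] X ϱ σ :=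
  ∑ a ∈ A, (coordFunctional ϱ σ a).smulRight (e ϱ σ a)

lemma finProj_apply (A : Finset Omega1) (x : X ϱ σ) :
    finProj ϱ σ A x = ∑ a ∈ A, coordFunctional ϱ σ a x • e ϱ σ a := by
  simp [finProj]

open scoped Classical in
lemma finProj_e (A : Finset Omega1) (β : Omega1) :
    finProj ϱ σ A (e ϱ σ β) = if β ∈ A then e ϱ σ β else 0 := by
  simp [finProj_apply, coordFunctional_e]

lemma finProj_coe (A : Finset Omega1) (x : C00 ϱ σ) :
    finProj ϱ σ A (x : X ϱ σ) = ((show C00 ϱ σ from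
      ∑ a ∈ A, Finsupp.single a ((show Omega1 →₀ ℝ from x) a) : C00 ϱ σ) : X ϱ σ) := by
  rw [finProj_apply]
  have hsum := map_sum (UniformSpace.Completion.toComplL (𝕜 := ℝ) (E := C00 ϱ σ))
    (fun a => (show C00 ϱ σ from Finsupp.single a ((show Omega1 →₀ ℝ from x) a))) A
  refine Eq.trans (Finset.sum_congr rfl fun a _ => ?_) hsum.symm
  rw [coordFunctional_coe, e, ← UniformSpace.Completion.coe_smul]
  refine congrArg _ ?_
  exact (Finsupp.smul_single _ _ _).trans (by rw [smul_eq_mul, mul_one])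

variable {ϱ σ}

lemma pairing_eq_sum (φ : Omega1 →₀ ℚ) (x : Omega1 →₀ ℝ) {s : Finset Omega1}
    (h : ∀ α ∉ s, φ α = 0) : pairing φ x = ∑ α ∈ s, (φ α : ℝ) * x α := by
  classical
  rw [pairing_apply]
  refine (Finset.sum_subset (Finset.subset_union_left (s₂ := s)) fun α _ hα => ?_).trans
    (Finset.sum_subset (Finset.subset_union_right (s₁ := x.support)) fun α _ hα => ?_).symm
  · simp [Finsupp.notMem_support_iff.1 hα]
  · simp [h α hα]

lemma pairing_sum_single (φ : Omega1 →₀ ℚ) (x : Omega1 →₀ ℝ) (A : Finset Omega1) :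
    pairing φ (∑ a ∈ A, Finsupp.single a (x a)) = pairing (restrict A φ) x := by
  rw [pairing_eq_sum (s := A) (restrict A φ) x
    fun α hα => restrict_apply_of_notMem (by simpa using hα) φ, map_sum]
  refine Finset.sum_congr rfl fun a ha => ?_
  rw [restrict_apply_of_mem (by simpa using ha)]
  simp [pairing]

lemma pairing_smul_left (c : ℚ) (φ : Omega1 →₀ ℚ) (x : Omega1 →₀ ℝ) :
    pairing (c • φ) x = c * pairing φ x := by
  simp [pairing_apply, Finset.mul_sum, mul_assoc]

/-- By duality, a finite set for which restriction maps the norming set into `C` times itself has a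
projection of norm at most `C`. -/
lemma norm_finProj_le {A : Finset Omega1} {C : ℚ} (hC : 0 ≤ C)
    (h : ∀ φ ∈ normingSet ϱ σ, restrict A φ ∈ C • normingSet ϱ σ) : ‖finProj ϱ σ A‖ ≤ C := by
  have hC' : (0 : ℝ) ≤ C := by exact_mod_cast hC
  refine ContinuousLinearMap.opNorm_le_bound _ hC' fun x => ?_
  induction x using UniformSpace.Completion.induction_on with
  | hp => exact isClosed_le (by fun_prop) (by fun_prop)
  | ih x =>
    rw [finProj_coe, UniformSpace.Completion.norm_coe, UniformSpace.Completion.norm_coe]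
    refine normK_le fun φ hφ => ?_
    obtain ⟨ψ, hψ, hψφ⟩ := h φ hφ
    refine (pairing_sum_single φ x A).le.trans ?_
    rw [← hψφ]
    refine (pairing_smul_left C ψ x).le.trans ?_
    exact mul_le_mul_of_nonneg_left ((le_abs_self _).trans (abs_pairing_le_normK hψ x)) hC'

/-- If `ϱ` is smooth, the projections onto the pieces of the sets `F_n^l` cut out by intervals are
bounded uniformly in `n`. -/
lemma norm_finProj_inter_le (hϱ : ϱ.IsSmooth) {l : Omega1}
    (hl : Order.IsSuccLimit (l : Ordinal.{0})) (n : ℕ) {I : Set Omega1} (hI : I.OrdConnected)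
    {B : Finset Omega1} (hB : (B : Set Omega1) = I ∩ ϱ.initial l n) :
    ‖finProj ϱ σ B‖ ≤ 2 + ⨆ k : ℕ+, ((ϱ.initial l k).card : ℝ) / (k : ℕ) := by
  obtain ⟨D, hD⟩ : ∃ D : ℚ, D = (ϱ.initial l n).card * (((n + 1 : ℕ) : ℚ) ^ 2)⁻¹ := ⟨_, rfl⟩
  have hD0 : 0 ≤ D := hD ▸ by positivity
  refine (norm_finProj_le (C := 2 + D) (by positivity) fun φ hφ => ?_).trans ?_
  · rw [hB, ← restrict_restrict]
    exact restrict_mem_smul_normingSet (restrict_initial_mem l n hD hφ) hI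
  · push_cast
    gcongr
    refine le_trans ?_ (le_ciSup (hϱ l hl) ⟨n + 1, n.succ_pos⟩)
    have h1 : (ϱ.initial l n).card ≤ (ϱ.initial l (n + 1)).card := by
      refine Finset.card_le_card fun α hα => ?_
      rw [RhoFunction.mem_initial] at hα ⊢
      exact ⟨hα.1, hα.2.trans n.le_succ⟩
    have h2 : (1 : ℝ) ≤ (n + 1 : ℕ) := by exact_mod_cast n.succ_pos
    rw [hD]
    simp only [PNat.mk_coe]
    push_cast at h2 ⊢
    rw [div_eq_mul_inv]
    gcongr
    nlinarith

lemma e_mem_XBelow {α β : Omega1} (h : β < α) : e ϱ σ β ∈ XBelow ϱ σ α :=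
  Submodule.le_topologicalClosure _ (Submodule.subset_span ⟨β, h, rfl⟩)

/-- A bounded sequence of operators that converges to the identity on each `e_β` with `β < α` does
so on `𝔛_α`. -/
lemma tendsto_of_mem_XBelow {T : ℕ → X ϱ σ →L[ℝ] X ϱ σ} {C : ℝ} (hC : ∀ n, ‖T n‖ ≤ C)
    {α : Omega1} (hT : ∀ β < α, Tendsto (fun n => T n (e ϱ σ β)) atTop (𝓝 (e ϱ σ β)))
    {x : X ϱ σ} (hx : x ∈ XBelow ϱ σ α) : Tendsto (fun n => T n x) atTop (𝓝 x) := by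
  have hspan : ∀ y ∈ Submodule.span ℝ (e ϱ σ '' Set.Iio α),
      Tendsto (fun n => T n y) atTop (𝓝 y) := by
    intro y hy
    induction hy using Submodule.span_induction with
    | mem y hy =>
      obtain ⟨β, hβ, rfl⟩ := hy
      exact hT β hβ
    | zero => simp
    | add y z _ _ h1 h2 => simpa using h1.add h2
    | smul c y _ h => simpa using h.const_smul c
  have hC0 : 0 ≤ C := (norm_nonneg _).trans (hC 0)
  rw [Metric.tendsto_atTop]
  intro ε hε
  obtain ⟨y, hy, hxy⟩ := Metric.mem_closure_iff.1 hx (ε / (C + 2)) (by positivity)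
  obtain ⟨N, hN⟩ := Metric.tendsto_atTop.1 (hspan y hy) (ε / (C + 2)) (by positivity)
  refine ⟨N, fun n hn => ?_⟩
  have h1 : dist (T n x) (T n y) ≤ C * dist x y := by
    rw [dist_eq_norm, dist_eq_norm, ← map_sub]
    exact (T n).le_of_opNorm_le (hC n) _
  have h2 : C * dist x y ≤ C * (ε / (C + 2)) := by gcongr
  calc dist (T n x) x ≤ dist (T n x) (T n y) + dist (T n y) y + dist y x := dist_triangle4 _ _ _ _
    _ < C * (ε / (C + 2)) + ε / (C + 2) + ε / (C + 2) := by
      rw [dist_comm y x]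
      exact add_lt_add (add_lt_add_of_le_of_lt (h1.trans h2) (hN n hn)) hxy
    _ = ε := by field_simp; ring

end Projections

/-! ### Bases of `𝔛_α` -/

lemma finProj_image {ϱ : RhoFunction} {σ : Coding} {ι : Type*} {α : Omega1} (s : ι ≃ Set.Iio α)
    [DecidableEq Omega1] (t : Finset ι) (x : X ϱ σ) :
    finProj ϱ σ (t.image fun i => (s i : Omega1)) x =
      ∑ i ∈ t, coordFunctional ϱ σ (s i) x • e ϱ σ (s i) := by
  rw [finProj_apply, Finset.sum_image]
  exact fun i _ j _ h => s.injective (Subtype.ext h)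

/-- An enumeration of `(e_β)_{β < α}` with uniformly bounded partial sum projections is a Schauder
basis of `𝔛_α`. -/
lemma exists_schauderBasis {ϱ : RhoFunction} {σ : Coding} {α : Omega1} (s : ℕ ≃ Set.Iio α)
    [DecidableEq Omega1] {C : ℝ}
    (hC : ∀ N, ‖finProj ϱ σ ((Finset.range N).image fun i => (s i : Omega1))‖ ≤ C) :
    ∃ b : SchauderBasis ℝ (XBelow ϱ σ α), ∀ n, (b n : X ϱ σ) = e ϱ σ (s n) := by
  classical
  refine ⟨{
    basis := fun n => ⟨e ϱ σ (s n), e_mem_XBelow (s n).2⟩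
    coord := fun n => (coordFunctional ϱ σ (s n)).comp (XBelow ϱ σ α).subtypeL
    ortho := fun i j => ?_
    expansion := fun x => ?_ }, fun n => rfl⟩
  · simp only [ContinuousLinearMap.comp_apply, Submodule.subtypeL_apply]
    rw [coordFunctional_e]
    simp [Pi.single_apply, Subtype.coe_inj, eq_comm]
  · rw [HasSum, SummationFilter.conditional_filter_eq_map_range, tendsto_map'_iff,
      tendsto_subtype_rng]
    refine (tendsto_of_mem_XBelow hC (fun β hβ => ?_) x.2).congr fun N => ?_
    · refine tendsto_const_nhds.congr' ?_
      filter_upwards [eventually_gt_atTop (s.symm ⟨β, hβ⟩)] with N hN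
      rw [finProj_e, if_pos]
      exact Finset.mem_image.2 ⟨_, Finset.mem_range.2 hN, by simp⟩
    · rw [finProj_image]
      simp

/-- An infinite linear order with a function `r` to `ℕ` all of whose sublevel sets are finite is
enumerated in order type `ω` by increasing `r`, and by the given order where `r` is constant. -/
lemma exists_equiv_nat_lex {T : Type*} [LinearOrder T] [Infinite T] (r : T → ℕ)
    (hr : ∀ n, {t | r t ≤ n}.Finite) :
    ∃ s : ℕ ≃ T, ∀ i j, i < j ↔ r (s i) < r (s j) ∨ (r (s i) = r (s j) ∧ s i < s j) := by
  let f : T → ℕ ×ₗ T := fun t => toLex (r t, t)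
  have hf : ∀ t u, f t < f u ↔ r t < r u ∨ (r t = r u ∧ t < u) := fun t u => Prod.Lex.toLex_lt_toLex
  have hfinj : Function.Injective f := fun t u h => (Prod.ext_iff.1 (toLex.injective h)).2
  let rank : T → ℕ := fun t => {u | f u < f t}.ncard
  have hfin : ∀ t, {u | f u < f t}.Finite := fun t => (hr (r t)).subset fun u hu => by
    rcases (hf u t).1 hu with h | h
    exacts [h.le, h.1.le]
  have hrank : ∀ t u, f t < f u → rank t < rank u := fun t u h =>
    Set.ncard_lt_ncard ⟨fun v hv => lt_trans (show f v < f t from hv) h,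
      fun hsub => lt_irrefl (f t) (hsub h)⟩ (hfin u)
  have hrank' : ∀ t u, rank t < rank u ↔ f t < f u := fun t u => by
    refine ⟨fun h => ?_, hrank t u⟩
    rcases lt_trichotomy (f t) (f u) with h' | h' | h'
    · exact h'
    · exact absurd h (hfinj h' ▸ lt_irrefl _)
    · exact absurd h (hrank u t h').not_gt
  have hinj : Function.Injective rank := fun t u h => hfinj <| by
    by_contra hne
    rcases lt_or_gt_of_ne hne with h' | h'
    exacts [(hrank _ _ h').ne h, (hrank _ _ h').ne h.symm]
  classical
  have : Infinite (Set.range rank) := Set.infinite_range_of_injective hinj |>.to_subtype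
  let o : ℕ ≃o Set.range rank := Nat.Subtype.orderIsoOfNat (Set.range rank)
  refine ⟨o.toEquiv.trans (Equiv.ofInjective rank hinj).symm, fun i j => ?_⟩
  have hs : ∀ i, rank ((Equiv.ofInjective rank hinj).symm (o i)) = o i := fun i =>
    Equiv.apply_ofInjective_symm hinj (o i)
  rw [← hf, ← hrank']
  simp only [Equiv.trans_apply, RelIso.coe_fn_toEquiv]
  rw [hs, hs, Subtype.coe_lt_coe, o.lt_iff_lt]

lemma exists_isSuccLimit_gt (α : Omega1) :
    ∃ l : Omega1, Order.IsSuccLimit (l : Ordinal.{0}) ∧ α < l := by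
  refine ⟨⟨α + Ordinal.omega0, ?_⟩, Ordinal.isSuccLimit_add _ Ordinal.isSuccLimit_omega0, ?_⟩
  · rw [Set.mem_Iio, Cardinal.lt_omega_iff_card_lt, Ordinal.card_add, Ordinal.card_omega0,
      Cardinal.lt_aleph_one_iff]
    refine Cardinal.add_le_aleph0.2 ⟨?_, le_rfl⟩
    exact Cardinal.lt_aleph_one_iff.1 (Cardinal.lt_omega_iff_card_lt.1 α.2)
  · exact (lt_add_of_pos_right (α : Ordinal.{0}) Ordinal.omega0_pos : (α : Ordinal.{0}) < _)

lemma infinite_Iio {α : Omega1} (hα : Ordinal.omega0 ≤ (α : Ordinal.{0})) :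
    Infinite (Set.Iio α) := by
  have hlt : ∀ n : ℕ, (n : Ordinal.{0}) < α := fun n => (Ordinal.natCast_lt_omega0 n).trans_le hα
  refine Infinite.of_injective
    (fun n : ℕ => (⟨⟨n, (hlt n).trans α.2⟩, hlt n⟩ : Set.Iio α)) fun m n h => ?_
  simpa using congrArg (fun β : Set.Iio α => ((β : Omega1) : Ordinal.{0})) h

/-- The basis is obtained by enumerating `α` along the sets `F_n^l ∩ α` for a limit `l > α`: every
initial segment of the enumeration consists of two pieces of such sets cut out by intervals. -/
theorem exists_schauderBasis_XBelow {ϱ : RhoFunction} (hϱ : ϱ.IsSmooth) (σ : Coding) {α : Omega1}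
    (hα : Ordinal.omega0 ≤ (α : Ordinal.{0})) :
    ∃ (b : SchauderBasis ℝ (XBelow ϱ σ α)) (s : ℕ ≃ Set.Iio α),
      ∀ n, (b n : X ϱ σ) = e ϱ σ (s n) := by
  classical
  obtain ⟨l, hl, hαl⟩ := exists_isSuccLimit_gt α
  have := infinite_Iio hα
  obtain ⟨s, hs⟩ := exists_equiv_nat_lex (fun β : Set.Iio α => ϱ.toFun β l) fun n => by
    refine ((ϱ.finite_le l n).preimage Subtype.val_injective.injOn).subset fun β hβ => ?_
    exact ⟨(show (β : Omega1) < α from β.2).trans hαl, hβ⟩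
  set C := 2 + ⨆ k : ℕ+, ((ϱ.initial l k).card : ℝ) / (k : ℕ)
  suffices h : ∀ N, ‖finProj ϱ σ ((Finset.range N).image fun i => (s i : Omega1))‖ ≤ C + C by
    obtain ⟨b, hb⟩ := exists_schauderBasis s h
    exact ⟨b, s, hb⟩
  intro N
  set A := (Finset.range N).image fun i => (s i : Omega1) with hA
  obtain ⟨β, hβ⟩ : ∃ β : Omega1, β = s N := ⟨_, rfl⟩
  have hβα : β < α := hβ ▸ (s N).2
  have hmem : ∀ γ, γ ∈ A ↔ γ < α ∧
      (ϱ.toFun γ l < ϱ.toFun β l ∨ (ϱ.toFun γ l = ϱ.toFun β l ∧ γ < β)) := by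
    intro γ
    simp only [hA, Finset.mem_image, Finset.mem_range, hβ]
    constructor
    · rintro ⟨i, hi, rfl⟩
      exact ⟨(s i).2, (hs i N).1 hi⟩
    · rintro ⟨h1, h2⟩
      refine ⟨s.symm ⟨γ, h1⟩, (hs _ N).2 ?_, by simp⟩
      rw [Equiv.apply_symm_apply]
      exact h2
  have hsplit : finProj ϱ σ A = finProj ϱ σ (A.filter (· < β)) + finProj ϱ σ (A.filter (¬ · < β)) :=
    (Finset.sum_filter_add_sum_filter_not A _ _).symm
  rw [hsplit]
  refine (norm_add_le _ _).trans (add_le_add ?_ ?_)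
  · refine norm_finProj_inter_le hϱ hl (ϱ.toFun β l) Set.ordConnected_Iio (I := Set.Iio β) ?_
    ext γ
    simp only [Finset.coe_filter, Set.mem_ofPred_eq, Set.mem_inter_iff, Set.mem_Iio,
      Finset.mem_coe, RhoFunction.mem_initial, hmem]
    constructor
    · rintro ⟨⟨h1, h2⟩, h3⟩
      exact ⟨h3, h1.trans hαl, by omega⟩
    · rintro ⟨h1, h2, h3⟩
      refine ⟨⟨h1.trans hβα, ?_⟩, h1⟩
      rcases h3.lt_or_eq with h | h
      exacts [Or.inl h, Or.inr ⟨h, h1⟩]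
  · rcases Nat.eq_zero_or_pos (ϱ.toFun β l) with h0 | hpos
    · refine norm_finProj_inter_le hϱ hl 0 Set.ordConnected_empty ?_
      ext γ
      simp only [Finset.coe_filter, Set.mem_ofPred_eq, hmem, h0, Set.empty_inter]
      simp +contextual
    · refine norm_finProj_inter_le hϱ hl (ϱ.toFun β l - 1) (Set.ordConnected_Ico (a := β) (b := α)) ?_
      ext γ
      simp only [Finset.coe_filter, Set.mem_ofPred_eq, Set.mem_inter_iff, Set.mem_Ico, not_lt,
        Finset.mem_coe, RhoFunction.mem_initial, hmem]
      constructor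
      · rintro ⟨⟨h1, h2⟩, h3⟩
        exact ⟨⟨h3, h1⟩, h1.trans hαl, by have := h2.resolve_right fun h => h.2.not_ge h3; omega⟩
      · rintro ⟨⟨h1, h2⟩, -, h3⟩
        exact ⟨⟨h2, Or.inl (by omega)⟩, h1⟩

lemma exists_equiv_fin_Iio {α : Omega1} {N : ℕ} (hα : (α : Ordinal.{0}) = N) :
    Nonempty (Fin N ≃ Set.Iio α) := by
  have hlt : ∀ n : Fin N, ((n : ℕ) : Ordinal.{0}) < α := fun n => by
    rw [hα]
    exact_mod_cast n.2
  refine ⟨Equiv.ofBijective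
    (fun n : Fin N => (⟨⟨(n : ℕ), (hlt n).trans α.2⟩, hlt n⟩ : Set.Iio α)) ⟨fun m n h => ?_, ?_⟩⟩
  · simpa [Fin.ext_iff] using congrArg (fun β : Set.Iio α => ((β : Omega1) : Ordinal.{0})) h
  · rintro ⟨⟨β, h1⟩, h2⟩
    have h3 : β < N := hα ▸ (h2 : β < (α : Ordinal.{0}))
    obtain ⟨k, rfl⟩ := Ordinal.lt_omega0.1 (h3.trans (Ordinal.natCast_lt_omega0 N))
    exact ⟨⟨k, by exact_mod_cast h3⟩, rfl⟩

theorem exists_basis_XBelow (ϱ : RhoFunction) (σ : Coding) {α : Omega1} {N : ℕ}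
    (hα : (α : Ordinal.{0}) = N) :
    ∃ (b : Module.Basis (Fin N) ℝ (XBelow ϱ σ α)) (s : Fin N ≃ Set.Iio α),
      ∀ n, (b n : X ϱ σ) = e ϱ σ (s n) := by
  classical
  obtain ⟨s⟩ := exists_equiv_fin_Iio hα
  let v : Fin N → XBelow ϱ σ α := fun n => ⟨e ϱ σ (s n), e_mem_XBelow (s n).2⟩
  have hli : LinearIndependent ℝ v := by
    rw [Fintype.linearIndependent_iff]
    intro g hg i
    have h := congrArg (fun x : XBelow ϱ σ α => coordFunctional ϱ σ (s i) x) hg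
    simpa [v, coordFunctional_e, Subtype.coe_inj] using h
  have hspan : ⊤ ≤ Submodule.span ℝ (Set.range v) := by
    rintro x -
    -- the projection onto all of `α` is the identity of `𝔛_α`
    have h := tendsto_of_mem_XBelow (ϱ := ϱ) (σ := σ) (T := fun _ => finProj ϱ σ
      (Finset.univ.image fun i => (s i : Omega1))) (fun _ => le_rfl) (fun β hβ => by
        rw [finProj_e, if_pos (Finset.mem_image.2 ⟨s.symm ⟨β, hβ⟩, Finset.mem_univ _, by simp⟩)]
        exact tendsto_const_nhds) x.2
    have hx := tendsto_nhds_unique tendsto_const_nhds h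
    rw [finProj_image] at hx
    have hx' : x = ∑ i, coordFunctional ϱ σ (s i) x • v i := by
      apply Subtype.ext
      simpa [v] using hx.symm
    rw [hx']
    exact Submodule.sum_mem _ fun i _ => Submodule.smul_mem _ _ (Submodule.subset_span ⟨i, rfl⟩)
  exact ⟨Module.Basis.mk hli hspan, s, fun n => by rw [Module.Basis.mk_apply]⟩

end RhoSpace

end

theorem mainTheorem12 :
    (∃ ϱ : RhoSpace.RhoFunction, ϱ.IsSmooth) ∧
    ∀ ϱ : RhoSpace.RhoFunction, ϱ.IsSmooth → ∀ σ : RhoSpace.Coding,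
      (∀ l : RhoSpace.Omega1, Order.IsSuccLimit (l : Ordinal.{0}) →
        ∃ Q : ℕ → RhoSpace.X ϱ σ →L[ℝ] RhoSpace.X ϱ σ,
          (∀ (n : ℕ) (β : RhoSpace.Omega1),
            (β ∈ ϱ.initial l n → Q n (RhoSpace.e ϱ σ β) = RhoSpace.e ϱ σ β) ∧
            (β ∉ ϱ.initial l n → Q n (RhoSpace.e ϱ σ β) = 0)) ∧
          (∀ n : ℕ, ‖Q n‖ ≤ 2 + ⨆ k : ℕ+, ((ϱ.initial l k).card : ℝ) / (k : ℕ)) ∧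
          (∀ x ∈ RhoSpace.XBelow ϱ σ l,
            Filter.Tendsto (fun n => Q n x) Filter.atTop (nhds x))) ∧
      (∀ α : RhoSpace.Omega1, Ordinal.omega0 ≤ (α : Ordinal.{0}) →
        ∃ (b : SchauderBasis ℝ (RhoSpace.XBelow ϱ σ α)) (s : ℕ ≃ Set.Iio α),
          ∀ n, (b n : RhoSpace.X ϱ σ) = RhoSpace.e ϱ σ (s n)) ∧
      (∀ (α : RhoSpace.Omega1) (N : ℕ), (α : Ordinal.{0}) = N →
        ∃ (b : Module.Basis (Fin N) ℝ (RhoSpace.XBelow ϱ σ α)) (s : Fin N ≃ Set.Iio α),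
          ∀ n, (b n : RhoSpace.X ϱ σ) = RhoSpace.e ϱ σ (s n)) := by
  refine ⟨RhoSpace.exists_isSmooth, fun ϱ hϱ σ => ⟨fun l hl => ?_,
    fun α hα => RhoSpace.exists_schauderBasis_XBelow hϱ σ hα,
    fun α N hα => RhoSpace.exists_basis_XBelow ϱ σ hα⟩⟩
  have hnorm : ∀ n, ‖RhoSpace.finProj ϱ σ (ϱ.initial l n)‖ ≤
      2 + ⨆ k : ℕ+, ((ϱ.initial l k).card : ℝ) / (k : ℕ) := fun n =>
    RhoSpace.norm_finProj_inter_le hϱ hl n Set.ordConnected_univ (Set.univ_inter _).symm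
  refine ⟨fun n => RhoSpace.finProj ϱ σ (ϱ.initial l n), fun n β => ⟨fun h => ?_, fun h => ?_⟩,
    hnorm, fun x hx => RhoSpace.tendsto_of_mem_XBelow hnorm (fun β hβ => ?_) hx⟩
  · rw [RhoSpace.finProj_e, if_pos h]
  · rw [RhoSpace.finProj_e, if_neg h]
  · refine tendsto_const_nhds.congr' ?_
    filter_upwards [Filter.eventually_ge_atTop (ϱ.toFun β l)] with n hn
    rw [RhoSpace.finProj_e, if_pos (RhoSpace.RhoFunction.mem_initial.2 ⟨hβ, hn⟩)]
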